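/- Notation. For each sample size $n$ let $p=p_n\ge 2$ features be partitioned into $D=D_n$ blocks, and let $X_1,\dots,X_n$ be i.i.d. $\mathcal N(0,\Sigma)$ in $\mathbb R^p$, with $\Sigma=\Sigma_n$, $\Sigma_{jj}=1$ for all $j$. Let $\Lambda$ be the block-diagonal part of $\Sigma$ (entries within blocks are kept, all others are set to $0$), let $\hat\Sigma=\frac1n\sum_{k}X_kX_k^\top$, let $\hat\Lambda$ be the block-diagonal part of $\hat\Sigma$, and let $f(\beta)=\beta^\top\hat\Sigma\beta/\beta^\top\hat\Lambda\beta$. For $j=1,\dots,p$ let $\xi_j$ be a maximizer of $\beta^\top\Sigma\beta/\beta^\top\Lambda\beta$ over all $\beta$ with $\|\beta\|_2=1$ and $\beta^\top\Lambda\xi_{j'}=0$ for all $j'<j$, and let $\rho_j=\xi_j^\top\Sigma\xi_j/\xi_j^\top\Lambda\xi_j$. Let $s=\|\xi_1\|_0$ be the number of non-zero entries of $\xi_1$. Assumptions. There are constants $M,\gamma,C>0$ such that for all $n$: every diagonal block $\Sigma_{[d][d]}$ has all eigenvalues in $[1/M,M]$; $\rho_1\ge 1+C$; $\rho_1-\rho_2\ge\gamma\rho_1$.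 Moreover, as $n\to\infty$, $p\to\infty$ and $\frac{s\ln p}{n}\to 0$. Algorithm. Let $0<c_0<1$, let $0<\eta\le\frac{1-c_0}{2M(M+3)}$ be a constant step size, let $c_{B_1},c_{B_2}>0$ be constants, let $L_0=(1+c_{B_1})\sqrt s$, let $1\le L_\infty\le L_0$ ($L_\infty$ may depend on $n$), and let $L_t=L_\infty+\bigl(1-c_{B_2}\eta\sqrt{\tfrac{s\ln p}{n}}\bigr)^t(L_0-L_\infty)$. Given a unit vector $\beta_0$, the iterates are $$\beta_{t+1}\in\arg\min_{\|\beta\|_2=1,\ \|\beta\|_1\le L_{t+1}}\|\beta-\theta_t\|_2^2,\qquad \theta_t=\beta_t+\frac{\eta}{f(\beta_t)}\bigl(\hat\Sigma-f(\beta_t)\hat\Lambda\bigr)\beta_t ,$$ any minimizer being allowed. Set $\delta_t=1-|\beta_t^\top\xi_1|$, $\nu=\frac{(1-c_0)\gamma^2}{M}$, $B_t=L_t-\|\xi_1\|_1$ and $$T^*=\sup\Bigl\{t:\ B_t\ge\frac{4c_{B_2}(1+c_{B_1})}{\nu}\sqrt{\frac{s^2\ln p}{n}}\Bigr\}\in\mathbb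 N\cup\{\infty\}$$ (which is a maximum for all large $n$ if $L_\infty\le\|\xi_1\|_1$). Theorem. There are constants $\psi_1,\psi_2>0$, depending only on $(M,\gamma,\eta,c_0,c_{B_1},c_{B_2})$, such that, with probability tending to $1$ as $n\to\infty$, for every (possibly data-dependent) unit vector $\beta_0$ with $\|\beta_0\|_1\le L_0$ and $\delta_0\le\psi_1$ and all iterates started from it, $$\delta_t\le\psi_2\left(\delta_0(1-\eta\nu)^t+\frac{s\ln p}{n}+\sqrt{\frac{s\ln p}{n}}\left(\frac{B_t}{\sqrt s}+\frac{B_t^2}{s}\right)\right)\qquad\text{for all } t\le T^*.$$ -/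

import Mathlib

namespace MsCCA

open MeasureTheory ProbabilityTheory

/-- The `ℓ₁` norm of a coordinate vector. -/
def l1norm {p : ℕ} (v : Fin p → ℝ) : ℝ := ∑ i, |v i|

/-- The number of non-zero coordinates of a vector. -/
noncomputable def l0norm {p : ℕ} (v : Fin p → ℝ) : ℕ := {i | v i ≠ 0}.ncard

/-- The vector has Euclidean norm one. -/
def IsUnitVec {p : ℕ} (v : Fin p → ℝ) : Prop := v ⬝ᵥ v = 1

/-- The `p` features are split into `D` blocks; `blk i` is the block of feature `i`.
`blockDiag blk H` keeps the within-block entries of `H` and sets the others to zero. -/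
def blockDiag {p D : ℕ} (blk : Fin p → Fin D) (H : Matrix (Fin p) (Fin p) ℝ) :
    Matrix (Fin p) (Fin p) ℝ :=
  Matrix.of fun i j => if blk i = blk j then H i j else 0

/-- The principal submatrix of `H` on the features of block `d`. -/
def block {p D : ℕ} (blk : Fin p → Fin D) (H : Matrix (Fin p) (Fin p) ℝ) (d : Fin D) :
    Matrix {i // blk i = d} {i // blk i = d} ℝ :=
  H.submatrix Subtype.val Subtype.val

/-- The generalized Rayleigh quotient `βᵀ S β / βᵀ Λ β`. -/
noncomputable def rayleigh {p : ℕ} (S Lam : Matrix (Fin p) (Fin p) ℝ) (β : Fin p → ℝ) : ℝ :=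
  (β ⬝ᵥ (S.mulVec β)) / (β ⬝ᵥ (Lam.mulVec β))

/-- `ξ 1, …, ξ p` are successive mCCA directions of the pair `(S, Lam)`: `ξ j` maximizes the
Rayleigh quotient among the unit vectors that are `Lam`-orthogonal to all `ξ j'` with `j' < j`.
The values of `ξ` outside `1, …, p` play no role. -/
def IsMCCADirections {p : ℕ} (S Lam : Matrix (Fin p) (Fin p) ℝ) (ξ : ℕ → Fin p → ℝ) : Prop :=
  ∀ j ∈ Finset.Icc 1 p,
    ξ j ∈ {β | IsUnitVec β ∧ ∀ j' ∈ Finset.Ico 1 j, β ⬝ᵥ (Lam.mulVec (ξ j')) = 0} ∧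
    IsMaxOn (rayleigh S Lam)
      {β | IsUnitVec β ∧ ∀ j' ∈ Finset.Ico 1 j, β ⬝ᵥ (Lam.mulVec (ξ j')) = 0} (ξ j)

/-- The rows of the `n × p` random matrix `X` are independent with law `N(0, S)`. -/
structure IsGaussianSample {Ω : Type*} [MeasurableSpace Ω] (P : Measure Ω) {n p : ℕ}
    (S : Matrix (Fin p) (Fin p) ℝ) (X : Ω → Matrix (Fin n) (Fin p) ℝ) : Prop where
  law : ∀ k, HasLaw (fun ω => WithLp.toLp 2 (X ω k)) (multivariateGaussian 0 S) P
  indep : iIndepFun (fun k ω => X ω k) P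

/-- The empirical covariance `Xᵀ X / n`. -/
noncomputable def empCov {n p : ℕ} (X : Matrix (Fin n) (Fin p) ℝ) : Matrix (Fin p) (Fin p) ℝ :=
  (n : ℝ)⁻¹ • (X.transpose * X)

/-- The proximal target `β + (η / f(β)) (S - f(β) Lam) β`, where `f` is the Rayleigh quotient. -/
noncomputable def proxTarget {p : ℕ} (S Lam : Matrix (Fin p) (Fin p) ℝ) (η : ℝ)
    (β : Fin p → ℝ) : Fin p → ℝ :=
  β + (η / rayleigh S Lam β) • ((S - rayleigh S Lam β • Lam).mulVec β)

/-- The unit vectors with `ℓ₁` norm at most `L`. -/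
def feasible (p : ℕ) (L : ℝ) : Set (Fin p → ℝ) := {β | IsUnitVec β ∧ l1norm β ≤ L}

/-- `β 0, β 1, …` is a run of the proximal gradient algorithm with bounds `L 1, L 2, …`:
`β (t+1)` is a feasible vector (any of them, if there are several) that is closest to the
proximal target of `β t` in Euclidean distance. -/
def IsProximalRun {p : ℕ} (S Lam : Matrix (Fin p) (Fin p) ℝ) (η : ℝ) (L : ℕ → ℝ)
    (β : ℕ → Fin p → ℝ) : Prop :=
  ∀ t, β (t + 1) ∈ feasible p (L (t + 1)) ∧
    IsMinOn (fun b => (b - proxTarget S Lam η (β t)) ⬝ᵥ (b - proxTarget S Lam η (β t)))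
      (feasible p (L (t + 1))) (β (t + 1))

/-- The discrepancy `1 - |βᵀ ξ|`. -/
def disc {p : ℕ} (ξ β : Fin p → ℝ) : ℝ := 1 - |β ⬝ᵥ ξ|

/-- `s ln p / n`. -/
noncomputable def rate (s p n : ℕ) : ℝ := (s : ℝ) * Real.log p / n

/-- The decaying bounds `L_t = L_∞ + (1 - c₂ η √(s ln p / n))^t (L₀ - L_∞)` with
`L₀ = (1 + c₁) √s`. -/
noncomputable def bound (c₁ c₂ η Linf : ℝ) (s p n t : ℕ) : ℝ :=
  Linf + (1 - c₂ * η * √(rate s p n)) ^ t * ((1 + c₁) * √(s : ℝ) - Linf)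

/-- `T* = max {t : B_t ≥ (4 c₂ (1 + c₁) / ν) √(s² ln p / n)}`, as a supremum in `ℕ ∪ {∞}`. -/
noncomputable def stopTime (c₁ c₂ ν : ℝ) (s p n : ℕ) (B : ℕ → ℝ) : ℕ∞ :=
  ⨆ t ∈ {t : ℕ | 4 * c₂ * (1 + c₁) / ν * √((s : ℝ) ^ 2 * Real.log p / n) ≤ B t}, (t : ℕ∞)

end MsCCA

/-
The Lyapunov function is the excess `Q β = βᵀ (Λ - S / ρ₁) β`. It vanishes at `±ξ₁`, and by the
eigengap it is comparable to the discrepancy on unit vectors.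

If the bilinear forms of the errors `(Σ̂ - Σ) / ρ₁` and `Λ̂ - Λ` are bounded by
`ε = O(√(s ln p / n))` relative to the norm `‖·‖₂ + ‖·‖₁ / √s`, which stays bounded along the run,
then `θ_t` is a gradient step for `Q` up to a small error. On unit vectors the projection maximizes
`β ↦ βᵀ θ_t`, so `β_{t+1}` can be compared with any feasible competitor. Moving `β_t` a fraction
`κ = η γ / M` of the way to `ξ₁` and normalizing gives a competitor that stays feasible as long as
the `ℓ₁` bound shrinks slowly compared to its slack `B_t`. The outcome is
`Q β_{t+1} ≤ (1 - η ν) Q β_t + O(ε B_t / √s)`. Up to time `T*` the slack decays more slowly than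
`(1 - η ν)^t`, so this recursion sums to the claimed bound.

For the error bound, a vector in the unit ball of the mixed norm, multiplied by `√s`, is an integer
vector with at most `s` as its sum of squares plus a remainder with sup norm at most `1` and `ℓ₁`
norm at most `s`; against any linear functional the remainder is dominated by another such integer
vector. By polarization only the quadratic forms at integer vectors with `kᵀk ≤ 4 s` matter. There
are at most `p` to the power `O(s)` of these, and at each of them the centred quadratic form is a
weighted sum of centred `χ²` variables, so a sub-exponential tail bound and a union bound suffice.
-/

namespace MsCCA

open Matrix MeasureTheory ProbabilityTheory
open scoped NNReal ENNReal

section Norms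

variable {ι : Type*} [Fintype ι] {p : ℕ}

/-- The Euclidean norm of a coordinate vector; the norm that Mathlib puts on `ι → ℝ` is the
sup norm. -/
noncomputable def l2norm (v : ι → ℝ) : ℝ := ‖WithLp.toLp 2 v‖

/-- The norm `‖v‖₂ + ‖v‖₁ / √s`, which is of the order of `‖v‖₂` on vectors with `s` non-zero
coordinates. The sampling errors are bounded in terms of it. -/
noncomputable def mixedNorm (s : ℕ) (v : Fin p → ℝ) : ℝ := l2norm v + l1norm v / √(s : ℝ)

theorem l2norm_nonneg (v : ι → ℝ) : 0 ≤ l2norm v := norm_nonneg _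

theorem l2norm_sq (v : ι → ℝ) : l2norm v ^ 2 = v ⬝ᵥ v := by
  simp only [l2norm, EuclideanSpace.real_norm_sq_eq, dotProduct, ← sq]

theorem l2norm_eq_zero {v : ι → ℝ} : l2norm v = 0 ↔ v = 0 := by
  rw [← sq_eq_zero_iff, l2norm_sq, dotProduct_self_eq_zero]

theorem IsUnitVec.l2norm_eq_one {v : Fin p → ℝ} (hv : IsUnitVec v) : l2norm v = 1 := by
  rwa [← sq_eq_sq₀ (l2norm_nonneg v) zero_le_one, l2norm_sq, one_pow]

theorem l2norm_add_le (u v : ι → ℝ) : l2norm (u + v) ≤ l2norm u + l2norm v :=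
  norm_add_le (WithLp.toLp 2 u) (WithLp.toLp 2 v)

theorem l2norm_sub_le (u v : ι → ℝ) : l2norm (u - v) ≤ l2norm u + l2norm v :=
  norm_sub_le (WithLp.toLp 2 u) (WithLp.toLp 2 v)

theorem l2norm_smul (c : ℝ) (v : ι → ℝ) : l2norm (c • v) = |c| * l2norm v :=
  norm_smul c (WithLp.toLp 2 v)

theorem l2norm_sub_sq {u v : Fin p → ℝ} (hu : IsUnitVec u) (hv : IsUnitVec v) :
    l2norm (u - v) ^ 2 = 2 - 2 * (u ⬝ᵥ v) := by
  unfold IsUnitVec at hu hv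
  rw [l2norm_sq, sub_dotProduct, dotProduct_sub, dotProduct_sub, hu, hv, dotProduct_comm v u]
  ring

theorem l1norm_nonneg (v : Fin p → ℝ) : 0 ≤ l1norm v := Finset.sum_nonneg fun _ _ => abs_nonneg _

theorem l1norm_add_le (u v : Fin p → ℝ) : l1norm (u + v) ≤ l1norm u + l1norm v := by
  unfold l1norm
  rw [← Finset.sum_add_distrib]
  exact Finset.sum_le_sum fun i _ => abs_add_le _ _

theorem l1norm_smul (c : ℝ) (v : Fin p → ℝ) : l1norm (c • v) = |c| * l1norm v := by
  simp [l1norm, abs_mul, Finset.mul_sum]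

theorem mixedNorm_nonneg (s : ℕ) (v : Fin p → ℝ) : 0 ≤ mixedNorm s v :=
  add_nonneg (l2norm_nonneg v) (div_nonneg (l1norm_nonneg v) (Real.sqrt_nonneg _))

theorem mixedNorm_smul (s : ℕ) (c : ℝ) (v : Fin p → ℝ) :
    mixedNorm s (c • v) = |c| * mixedNorm s v := by
  rw [mixedNorm, mixedNorm, l2norm_smul, l1norm_smul]
  ring

theorem mixedNorm_neg (s : ℕ) (v : Fin p → ℝ) : mixedNorm s (-v) = mixedNorm s v := by
  simpa using mixedNorm_smul s (-1) v

theorem mixedNorm_add_le (s : ℕ) (u v : Fin p → ℝ) :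
    mixedNorm s (u + v) ≤ mixedNorm s u + mixedNorm s v := by
  calc mixedNorm s (u + v)
      ≤ (l2norm u + l2norm v) + (l1norm u + l1norm v) / √(s : ℝ) := by
        unfold mixedNorm
        gcongr
        exacts [l2norm_add_le u v, l1norm_add_le u v]
    _ = mixedNorm s u + mixedNorm s v := by
        unfold mixedNorm
        ring

theorem mixedNorm_sub_le (s : ℕ) (u v : Fin p → ℝ) :
    mixedNorm s (u - v) ≤ mixedNorm s u + mixedNorm s v := by
  simpa [sub_eq_add_neg, mixedNorm_neg] using mixedNorm_add_le s u (-v)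

theorem IsUnitVec.mixedNorm_le {s : ℕ} (hs : 0 < s) {v : Fin p → ℝ} (hv : IsUnitVec v) {c : ℝ}
    (h : l1norm v ≤ c * √(s : ℝ)) : mixedNorm s v ≤ 1 + c := by
  rw [mixedNorm, hv.l2norm_eq_one, add_le_add_iff_left, div_le_iff₀ (by positivity)]
  exact h

theorem l0norm_eq_card (ξ : Fin p → ℝ) :
    l0norm ξ = (Finset.univ.filter fun i => ξ i ≠ 0).card := by
  rw [l0norm, ← Set.ncard_coe_finset]
  simp

theorem l0norm_neg (v : Fin p → ℝ) : l0norm (-v) = l0norm v := by simp [l0norm]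

theorem l1norm_neg (v : Fin p → ℝ) : l1norm (-v) = l1norm v := by simp [l1norm]

theorem sum_support_abs_le (ξ v : Fin p → ℝ) :
    ∑ i with ξ i ≠ 0, |v i| ≤ √(l0norm ξ : ℝ) * l2norm v := by
  refine abs_le_of_sq_le_sq' ?_ (mul_nonneg (Real.sqrt_nonneg _) (l2norm_nonneg v)) |>.2
  calc (∑ i with ξ i ≠ 0, |v i|) ^ 2 ≤ (l0norm ξ : ℝ) * ∑ i with ξ i ≠ 0, |v i| ^ 2 := by
        rw [l0norm_eq_card]
        exact sq_sum_le_card_mul_sum_sq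
    _ ≤ l0norm ξ * ∑ i, |v i| ^ 2 := by
        gcongr
        exact Finset.subset_univ _
    _ = (√(l0norm ξ : ℝ) * l2norm v) ^ 2 := by
        simp only [mul_pow, Real.sq_sqrt (Nat.cast_nonneg _), l2norm_sq, sq_abs, dotProduct, ← sq]

theorem l1norm_le_sqrt_l0norm (ξ : Fin p → ℝ) : l1norm ξ ≤ √(l0norm ξ : ℝ) * l2norm ξ := by
  have support : ∑ i with ξ i ≠ 0, |ξ i| = l1norm ξ :=
    Finset.sum_filter_of_ne fun i _ hi => abs_ne_zero.1 hi
  exact support.symm.trans_le (sum_support_abs_le ξ ξ)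

theorem l1norm_sub_le (ξ β : Fin p → ℝ) :
    l1norm (β - ξ) ≤ l1norm β - l1norm ξ + 2 * √(l0norm ξ : ℝ) * l2norm (β - ξ) := by
  have coordinatewise : l1norm (β - ξ)
      ≤ l1norm β - l1norm ξ + 2 * ∑ i with ξ i ≠ 0, |(β - ξ) i| := by
    unfold l1norm
    rw [Finset.sum_filter, Finset.mul_sum, ← Finset.sum_sub_distrib, ← Finset.sum_add_distrib]
    refine Finset.sum_le_sum fun i _ => ?_
    by_cases hi : ξ i = 0
    · simp [hi]
    · have := abs_sub_abs_le_abs_sub (ξ i) (β i)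
      rw [abs_sub_comm] at this
      simp only [ne_eq, hi, not_false_eq_true, if_true, Pi.sub_apply]
      linarith
  linarith [sum_support_abs_le ξ (β - ξ)]

theorem mixedNorm_sub_le_of_l1norm_le {ξ β : Fin p → ℝ} (hs : 0 < l0norm ξ) {b : ℝ}
    (h : l1norm β ≤ l1norm ξ + b * √(l0norm ξ : ℝ)) :
    mixedNorm (l0norm ξ) (β - ξ) ≤ 3 * l2norm (β - ξ) + b := by
  have : l1norm (β - ξ) / √(l0norm ξ : ℝ) ≤ 2 * l2norm (β - ξ) + b := by
    rw [div_le_iff₀ (by positivity)]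
    linarith [l1norm_sub_le ξ β]
  unfold mixedNorm
  linarith

end Norms

section QuadraticForms

variable {ι : Type*} [Fintype ι] {A : Matrix ι ι ℝ}

theorem dotProduct_mulVec_comm_of_isHermitian (hA : A.IsHermitian) (u v : ι → ℝ) :
    u ⬝ᵥ A *ᵥ v = v ⬝ᵥ A *ᵥ u := by
  rw [dotProduct_mulVec, ← mulVec_transpose, ← conjTranspose_eq_transpose_of_trivial, hA.eq,
    dotProduct_comm]

theorem quad_add (hA : A.IsHermitian) (u v : ι → ℝ) :
    (u + v) ⬝ᵥ A *ᵥ (u + v) = u ⬝ᵥ A *ᵥ u + 2 * (u ⬝ᵥ A *ᵥ v) + v ⬝ᵥ A *ᵥ v := by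
  rw [mulVec_add, add_dotProduct, dotProduct_add, dotProduct_add,
    dotProduct_mulVec_comm_of_isHermitian hA v u]
  ring

theorem quad_sub (hA : A.IsHermitian) (u v : ι → ℝ) :
    (u - v) ⬝ᵥ A *ᵥ (u - v) = u ⬝ᵥ A *ᵥ u - 2 * (u ⬝ᵥ A *ᵥ v) + v ⬝ᵥ A *ᵥ v := by
  rw [mulVec_sub, sub_dotProduct, dotProduct_sub, dotProduct_sub,
    dotProduct_mulVec_comm_of_isHermitian hA v u]
  ring

theorem quad_nonneg (hA : A.PosSemidef) (u : ι → ℝ) : 0 ≤ u ⬝ᵥ A *ᵥ u := by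
  simpa using hA.dotProduct_mulVec_nonneg u

theorem mulVec_eq_zero_of_quad_eq_zero (hA : A.PosSemidef) {u : ι → ℝ} (hu : u ⬝ᵥ A *ᵥ u = 0) :
    A *ᵥ u = 0 :=
  (hA.dotProduct_mulVec_zero_iff u).1 (by simpa using hu)

theorem sq_dotProduct_mulVec_le (hA : A.PosSemidef) (u v : ι → ℝ) :
    (u ⬝ᵥ A *ᵥ v) ^ 2 ≤ (u ⬝ᵥ A *ᵥ u) * (v ⬝ᵥ A *ᵥ v) := by
  classical
  have symm : LinearMap.IsSymm (toBilin' A) := ⟨fun x y => by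
    simpa [toBilin'_apply'] using dotProduct_mulVec_comm_of_isHermitian hA.isHermitian x y⟩
  simpa only [toBilin'_apply'] using LinearMap.BilinForm.apply_sq_le_of_symm (toBilin' A)
    (fun x => by simpa only [toBilin'_apply'] using quad_nonneg hA x) symm u v

theorem abs_dotProduct_mulVec_le (hA : A.PosSemidef) {K : ℝ} (hK : 0 ≤ K)
    (hAK : ∀ u, u ⬝ᵥ A *ᵥ u ≤ K * (u ⬝ᵥ u)) (u v : ι → ℝ) :
    |u ⬝ᵥ A *ᵥ v| ≤ K * (l2norm u * l2norm v) := by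
  simp only [← l2norm_sq] at hAK
  refine abs_le_of_sq_le_sq ?_ (by have := l2norm_nonneg u; have := l2norm_nonneg v; positivity)
  calc (u ⬝ᵥ A *ᵥ v) ^ 2 ≤ (u ⬝ᵥ A *ᵥ u) * (v ⬝ᵥ A *ᵥ v) := sq_dotProduct_mulVec_le hA u v
    _ ≤ (K * l2norm u ^ 2) * (K * l2norm v ^ 2) := by
        gcongr
        exacts [quad_nonneg hA v, hAK u, hAK v]
    _ = (K * (l2norm u * l2norm v)) ^ 2 := by ring

end QuadraticForms

section LeadingPair

variable {p : ℕ}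

/-- The matrix `Λ - S / ρ`. For `ρ` the largest generalized eigenvalue of `(S, Λ)` it is positive
semidefinite with the leading direction in its kernel. -/
noncomputable def excessMatrix (ρ : ℝ) (S Lam : Matrix (Fin p) (Fin p) ℝ) :
    Matrix (Fin p) (Fin p) ℝ :=
  Lam - ρ⁻¹ • S

/-- The Lyapunov function `βᵀ (Λ - S / ρ) β` of the algorithm. -/
noncomputable def excess (ρ : ℝ) (S Lam : Matrix (Fin p) (Fin p) ℝ) (β : Fin p → ℝ) : ℝ :=
  β ⬝ᵥ excessMatrix ρ S Lam *ᵥ β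

/-- `ξ` is the leading direction, with generalized eigenvalue `ρ`, of a population pair `(S, Λ)`
with conditioning constant `M` and relative eigengap `γ`. -/
structure IsLeadingPair (M γ ρ : ℝ) (S Lam : Matrix (Fin p) (Fin p) ℝ) (ξ : Fin p → ℝ) :
    Prop where
  rho_pos : 0 < ρ
  gap_le_one : γ ≤ 1
  unit : IsUnitVec ξ
  cov_posSemidef : S.PosSemidef
  diag_lower : ∀ u, u ⬝ᵥ u ≤ M * (u ⬝ᵥ Lam *ᵥ u)
  diag_upper : ∀ u, u ⬝ᵥ Lam *ᵥ u ≤ M * (u ⬝ᵥ u)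
  excess_posSemidef : (excessMatrix ρ S Lam).PosSemidef
  excess_mulVec : excessMatrix ρ S Lam *ᵥ ξ = 0
  gap : ∀ u, IsUnitVec u → γ * (1 - (u ⬝ᵥ ξ) ^ 2) ≤ M * excess ρ S Lam u

theorem excess_eq (ρ : ℝ) (S Lam : Matrix (Fin p) (Fin p) ℝ) (u : Fin p → ℝ) :
    excess ρ S Lam u = u ⬝ᵥ Lam *ᵥ u - ρ⁻¹ * (u ⬝ᵥ S *ᵥ u) := by
  simp only [excess, excessMatrix, sub_mulVec, smul_mulVec, dotProduct_sub, dotProduct_smul,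
    smul_eq_mul]

namespace IsLeadingPair

variable {M γ ρ : ℝ} {S Lam : Matrix (Fin p) (Fin p) ℝ} {ξ : Fin p → ℝ}

theorem neg (h : IsLeadingPair M γ ρ S Lam ξ) : IsLeadingPair M γ ρ S Lam (-ξ) where
  __ := h
  unit := by simpa [IsUnitVec] using h.unit
  excess_mulVec := by rw [mulVec_neg, h.excess_mulVec, neg_zero]
  gap u hu := by simpa using h.gap u hu

theorem one_le (h : IsLeadingPair M γ ρ S Lam ξ) (hM : 0 < M) : 1 ≤ M := by
  have lower := h.diag_lower ξ
  have upper := mul_le_mul_of_nonneg_left (h.diag_upper ξ) hM.le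
  rw [h.unit] at lower upper
  nlinarith

theorem excess_nonneg (h : IsLeadingPair M γ ρ S Lam ξ) (u : Fin p → ℝ) : 0 ≤ excess ρ S Lam u :=
  quad_nonneg h.excess_posSemidef u

theorem excess_le (h : IsLeadingPair M γ ρ S Lam ξ) (u : Fin p → ℝ) :
    excess ρ S Lam u ≤ M * (u ⬝ᵥ u) := by
  have := mul_nonneg (inv_nonneg.2 h.rho_pos.le) (quad_nonneg h.cov_posSemidef u)
  rw [excess_eq]
  linarith [h.diag_upper u]

theorem excess_sub (h : IsLeadingPair M γ ρ S Lam ξ) (u : Fin p → ℝ) :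
    excess ρ S Lam (u - ξ) = excess ρ S Lam u := by
  simp only [excess, quad_sub h.excess_posSemidef.isHermitian, h.excess_mulVec, dotProduct_zero,
    mul_zero, sub_zero, add_zero]

theorem cov_le (h : IsLeadingPair M γ ρ S Lam ξ) (u : Fin p → ℝ) :
    u ⬝ᵥ S *ᵥ u ≤ ρ * (u ⬝ᵥ Lam *ᵥ u) := by
  rw [← inv_mul_le_iff₀ h.rho_pos, ← sub_nonneg, ← excess_eq]
  exact h.excess_nonneg u

theorem abs_inv_rho_mul_cov_le (h : IsLeadingPair M γ ρ S Lam ξ) (hM : 0 < M)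
    (u v : Fin p → ℝ) : |ρ⁻¹ * (u ⬝ᵥ S *ᵥ v)| ≤ M * (l2norm u * l2norm v) := by
  have hρ := h.rho_pos
  rw [abs_mul, abs_of_pos (inv_pos.2 hρ), inv_mul_le_iff₀ hρ, ← mul_assoc]
  refine abs_dotProduct_mulVec_le h.cov_posSemidef (by positivity) (fun w => ?_) u v
  rw [mul_assoc]
  exact (h.cov_le w).trans (mul_le_mul_of_nonneg_left (h.diag_upper w) hρ.le)

theorem sub_sq_div_le_excess (h : IsLeadingPair M γ ρ S Lam ξ) (hγ : 0 < γ) {β : Fin p → ℝ}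
    (hβ : IsUnitVec β) :
    l2norm (β - ξ) ^ 2 - (l2norm (β - ξ) ^ 2) ^ 2 / 4 ≤ M / γ * excess ρ S Lam β := by
  have inner_sq : 1 - (β ⬝ᵥ ξ) ^ 2 = l2norm (β - ξ) ^ 2 - (l2norm (β - ξ) ^ 2) ^ 2 / 4 := by
    rw [l2norm_sub_sq hβ h.unit]
    ring
  rw [← inner_sq, div_mul_eq_mul_div, le_div_iff₀' hγ]
  exact h.gap β hβ

theorem l2norm_sub_sq_le_excess (h : IsLeadingPair M γ ρ S Lam ξ) (hγ : 0 < γ) {β : Fin p → ℝ}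
    (hβ : IsUnitVec β) (hsign : 0 ≤ β ⬝ᵥ ξ) :
    l2norm (β - ξ) ^ 2 ≤ 2 * M / γ * excess ρ S Lam β := by
  have dist_le : l2norm (β - ξ) ^ 2 ≤ 2 := by linarith [l2norm_sub_sq hβ h.unit]
  have := h.sub_sq_div_le_excess hγ hβ
  rw [mul_div_assoc, mul_assoc]
  nlinarith [sq_nonneg (l2norm (β - ξ))]

end IsLeadingPair

end LeadingPair

section Perturbation

variable {p : ℕ}

/-- The bilinear form of `E` is bounded by `ε` relative to `mixedNorm s` in both arguments. -/
def HasMixedBound (s : ℕ) (E : Matrix (Fin p) (Fin p) ℝ) (ε : ℝ) : Prop :=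
  ∀ u v, |u ⬝ᵥ E *ᵥ v| ≤ ε * mixedNorm s u * mixedNorm s v

/-- The pair `(Sh, Lh)` approximates the population pair `(S, Λ)` up to the relative error `ε`. -/
structure IsPerturbedPair (M γ ρ ε : ℝ) (S Lam Sh Lh : Matrix (Fin p) (Fin p) ℝ)
    (ξ : Fin p → ℝ) : Prop extends IsLeadingPair M γ ρ S Lam ξ where
  err_nonneg : 0 ≤ ε
  cov_bound : HasMixedBound (l0norm ξ) (Sh - S) (ρ * ε)
  diag_bound : HasMixedBound (l0norm ξ) (Lh - Lam) ε

theorem proxTarget_eq {Sh Lh : Matrix (Fin p) (Fin p) ℝ} {β : Fin p → ℝ}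
    (hf : rayleigh Sh Lh β ≠ 0) (η : ℝ) :
    proxTarget Sh Lh η β = β - η • excessMatrix (rayleigh Sh Lh β) Sh Lh *ᵥ β := by
  simp only [proxTarget, excessMatrix, sub_mulVec, smul_mulVec, smul_sub, smul_smul,
    div_mul_cancel₀ η hf, ← div_eq_mul_inv]
  abel

theorem abs_div_sub_one_le {a b c δ : ℝ} (hc : 0 < c) (hb : 1 ≤ c * b) (h : |a - b| ≤ δ) :
    |a / b - 1| ≤ c * δ := by
  have hb0 : 0 < b := pos_of_mul_pos_right (by linarith) hc.le
  rw [div_sub_one hb0.ne', abs_div, abs_of_pos hb0, div_le_iff₀ hb0]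
  nlinarith [(abs_nonneg (a - b)).trans h]

namespace IsPerturbedPair

variable {M γ ρ ε K : ℝ} {S Lam Sh Lh : Matrix (Fin p) (Fin p) ℝ} {ξ β : Fin p → ℝ}

theorem neg (h : IsPerturbedPair M γ ρ ε S Lam Sh Lh ξ) :
    IsPerturbedPair M γ ρ ε S Lam Sh Lh (-ξ) where
  toIsLeadingPair := h.toIsLeadingPair.neg
  err_nonneg := h.err_nonneg
  cov_bound := (l0norm_neg ξ).symm ▸ h.cov_bound
  diag_bound := (l0norm_neg ξ).symm ▸ h.diag_bound

theorem abs_cov_err_le (h : IsPerturbedPair M γ ρ ε S Lam Sh Lh ξ)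
    (hK : mixedNorm (l0norm ξ) β ≤ K) (u : Fin p → ℝ) :
    |ρ⁻¹ * (u ⬝ᵥ (Sh - S) *ᵥ β)| ≤ ε * K * mixedNorm (l0norm ξ) u := by
  have hρ := h.rho_pos
  have hu := mixedNorm_nonneg (l0norm ξ) u
  have hε := h.err_nonneg
  rw [abs_mul, abs_of_pos (inv_pos.2 hρ), inv_mul_le_iff₀ hρ]
  calc |u ⬝ᵥ (Sh - S) *ᵥ β| ≤ ρ * ε * mixedNorm (l0norm ξ) u * mixedNorm (l0norm ξ) β :=
        h.cov_bound u β
    _ ≤ ρ * ε * mixedNorm (l0norm ξ) u * K := by gcongr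
    _ = ρ * (ε * K * mixedNorm (l0norm ξ) u) := by ring

theorem abs_diag_err_le (h : IsPerturbedPair M γ ρ ε S Lam Sh Lh ξ)
    (hK : mixedNorm (l0norm ξ) β ≤ K) (u : Fin p → ℝ) :
    |u ⬝ᵥ (Lh - Lam) *ᵥ β| ≤ ε * K * mixedNorm (l0norm ξ) u := by
  have hu := mixedNorm_nonneg (l0norm ξ) u
  have hε := h.err_nonneg
  calc |u ⬝ᵥ (Lh - Lam) *ᵥ β| ≤ ε * mixedNorm (l0norm ξ) u * mixedNorm (l0norm ξ) β :=
        h.diag_bound u β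
    _ ≤ ε * mixedNorm (l0norm ξ) u * K := by gcongr
    _ = ε * K * mixedNorm (l0norm ξ) u := by ring

theorem abs_rho_div_rayleigh_sub_one_le (h : IsPerturbedPair M γ ρ ε S Lam Sh Lh ξ) (hM : 0 < M)
    (hβ : IsUnitVec β) (hK : mixedNorm (l0norm ξ) β ≤ K) (hε : 2 * ε * K ^ 2 ≤ 1 / (4 * M))
    (hQ : excess ρ S Lam β ≤ 1 / (4 * M)) :
    0 < rayleigh Sh Lh β ∧
      |ρ / rayleigh Sh Lh β - 1| ≤ 2 * M * (excess ρ S Lam β + 2 * ε * K ^ 2) := by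
  have hρ := h.rho_pos
  have hεK : 0 ≤ ε * K := mul_nonneg h.err_nonneg ((mixedNorm_nonneg _ _).trans hK)
  have err_sq : ε * K * mixedNorm (l0norm ξ) β ≤ ε * K ^ 2 := by
    rw [sq, ← mul_assoc]
    gcongr
  have cov_err := (h.abs_cov_err_le hK β).trans err_sq
  have diag_err := (h.abs_diag_err_le hK β).trans err_sq
  have excess_nonneg := h.excess_nonneg β
  have diag_lower := h.diag_lower β
  rw [hβ, ← div_le_iff₀' hM] at diag_lower
  have inv_M : 1 / M = 4 * (1 / (4 * M)) := by field_simp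
  rw [sub_mulVec, dotProduct_sub, abs_le] at cov_err diag_err
  rw [excess_eq] at hQ excess_nonneg ⊢
  obtain ⟨N, hN⟩ : ∃ N, N = ρ⁻¹ * (β ⬝ᵥ Sh *ᵥ β) := ⟨_, rfl⟩
  rw [mul_sub, ← hN] at cov_err
  have num_lower : 1 / (2 * M) ≤ N := by
    have : 1 / (2 * M) = 2 * (1 / (4 * M)) := by field_simp; norm_num
    linarith
  have num_pos : 0 < N := lt_of_lt_of_le (by positivity) num_lower
  have den_pos : 0 < β ⬝ᵥ Lh *ᵥ β := by
    have : 0 < 1 / (4 * M) := by positivity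
    linarith
  have rayleigh_eq : rayleigh Sh Lh β = ρ * N / (β ⬝ᵥ Lh *ᵥ β) := by
    rw [rayleigh, hN, mul_inv_cancel_left₀ hρ.ne']
  refine ⟨by rw [rayleigh_eq]; positivity, ?_⟩
  have ratio : ρ / rayleigh Sh Lh β = (β ⬝ᵥ Lh *ᵥ β) / N := by
    rw [rayleigh_eq]
    field_simp
  rw [ratio]
  refine abs_div_sub_one_le (by positivity) (by rwa [← div_le_iff₀' (by positivity)]) ?_
  exact abs_le.2 ⟨by linarith, by linarith⟩

theorem abs_gradient_err_le (h : IsPerturbedPair M γ ρ ε S Lam Sh Lh ξ) (hM : 0 < M)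
    (hβ : IsUnitVec β) (hK : mixedNorm (l0norm ξ) β ≤ K) (hε : 2 * ε * K ^ 2 ≤ 1 / (4 * M))
    (hQ : excess ρ S Lam β ≤ 1 / (4 * M)) (u : Fin p → ℝ) :
    |u ⬝ᵥ excessMatrix (rayleigh Sh Lh β) Sh Lh *ᵥ β - u ⬝ᵥ excessMatrix ρ S Lam *ᵥ β|
      ≤ 3 * ε * K * mixedNorm (l0norm ξ) u
        + 2 * M ^ 2 * (excess ρ S Lam β + 2 * ε * K ^ 2) * l2norm u := by
  have hρ := h.rho_pos.ne'
  obtain ⟨hf, ratio_le⟩ := h.abs_rho_div_rayleigh_sub_one_le hM hβ hK hε hQ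
  set f := rayleigh Sh Lh β
  obtain ⟨τ, hτ⟩ : ∃ τ, τ = ρ / f - 1 := ⟨_, rfl⟩
  rw [← hτ] at ratio_le
  have ratio_le_one : |τ| ≤ 1 := by
    refine ratio_le.trans ?_
    calc 2 * M * (excess ρ S Lam β + 2 * ε * K ^ 2) ≤ 2 * M * (1 / (4 * M) + 1 / (4 * M)) := by
          gcongr
      _ = 1 := by field_simp; norm_num
  have decomposition : u ⬝ᵥ excessMatrix f Sh Lh *ᵥ β - u ⬝ᵥ excessMatrix ρ S Lam *ᵥ β
      = u ⬝ᵥ (Lh - Lam) *ᵥ β - (1 + τ) * (ρ⁻¹ * (u ⬝ᵥ (Sh - S) *ᵥ β))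
        - τ * (ρ⁻¹ * (u ⬝ᵥ S *ᵥ β)) := by
    simp only [hτ, excessMatrix, sub_mulVec, smul_mulVec, dotProduct_sub, dotProduct_smul,
      smul_eq_mul]
    field_simp
    ring
  have diag_part := h.abs_diag_err_le hK u
  have cov_part : |(1 + τ) * (ρ⁻¹ * (u ⬝ᵥ (Sh - S) *ᵥ β))|
      ≤ 2 * (ε * K * mixedNorm (l0norm ξ) u) := by
    rw [abs_mul]
    refine mul_le_mul ?_ (h.abs_cov_err_le hK u) (abs_nonneg _) zero_le_two
    linarith [abs_add_le 1 τ, abs_one (α := ℝ)]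
  have ratio_part : |τ * (ρ⁻¹ * (u ⬝ᵥ S *ᵥ β))|
      ≤ 2 * M * (excess ρ S Lam β + 2 * ε * K ^ 2) * (M * l2norm u) := by
    have := h.abs_inv_rho_mul_cov_le hM u β
    rw [hβ.l2norm_eq_one, mul_one] at this
    rw [abs_mul]
    exact mul_le_mul ratio_le this (abs_nonneg _) ((abs_nonneg _).trans ratio_le)
  rw [decomposition]
  refine (abs_sub _ _).trans ((add_le_add_left (abs_sub _ _) _).trans ?_)
  linarith

end IsPerturbedPair

end Perturbation

section Interpolation

variable {p : ℕ}

/-- The convex combination `(1 - κ) β + κ ξ`, projected to the unit sphere. It is the competitor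
against which the next iterate is compared. -/
noncomputable def interpolant (κ : ℝ) (β ξ : Fin p → ℝ) : Fin p → ℝ :=
  (l2norm (AffineMap.lineMap β ξ κ))⁻¹ • AffineMap.lineMap β ξ κ

variable {κ : ℝ} {β ξ : Fin p → ℝ}

theorem dotProduct_eq_one_sub (hβ : IsUnitVec β) (hξ : IsUnitVec ξ) :
    β ⬝ᵥ ξ = 1 - l2norm (β - ξ) ^ 2 / 2 := by
  rw [l2norm_sub_sq hβ hξ]
  ring

theorem interpolant_eq (κ : ℝ) (β ξ : Fin p → ℝ) :
    interpolant κ β ξ = ((l2norm (AffineMap.lineMap β ξ κ))⁻¹ * (1 - κ)) • β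
      + ((l2norm (AffineMap.lineMap β ξ κ))⁻¹ * κ) • ξ := by
  rw [interpolant, ← smul_smul, ← smul_smul, ← smul_add, AffineMap.lineMap_apply_module]

theorem l2norm_lineMap_sq (hβ : IsUnitVec β) (hξ : IsUnitVec ξ) (κ : ℝ) :
    l2norm (AffineMap.lineMap β ξ κ) ^ 2 = 1 - κ * (1 - κ) * l2norm (β - ξ) ^ 2 := by
  rw [l2norm_sub_sq hβ hξ]
  unfold IsUnitVec at hβ hξ
  simp only [l2norm_sq, AffineMap.lineMap_apply_module, add_dotProduct, dotProduct_add,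
    smul_dotProduct, dotProduct_smul, smul_eq_mul, hβ, hξ, dotProduct_comm ξ β]
  ring

theorem one_sub_le_l2norm_lineMap (hβ : IsUnitVec β) (hξ : IsUnitVec ξ) (hκ : 0 ≤ κ)
    (hκx : κ * l2norm (β - ξ) ^ 2 ≤ 1) :
    1 - κ * l2norm (β - ξ) ^ 2 ≤ l2norm (AffineMap.lineMap β ξ κ) := by
  refine abs_le_of_sq_le_sq' ?_ (l2norm_nonneg _) |>.2
  rw [l2norm_lineMap_sq hβ hξ]
  nlinarith [mul_nonneg hκ (sq_nonneg (l2norm (β - ξ))),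
    mul_nonneg (sq_nonneg κ) (sq_nonneg (l2norm (β - ξ)))]

theorem l2norm_lineMap_pos (hβ : IsUnitVec β) (hξ : IsUnitVec ξ) (hκ : 0 ≤ κ)
    (hκx : κ * l2norm (β - ξ) ^ 2 ≤ 1 / 2) : 0 < l2norm (AffineMap.lineMap β ξ κ) := by
  linarith [one_sub_le_l2norm_lineMap hβ hξ hκ (hκx.trans (by norm_num))]

theorem isUnitVec_interpolant (hβ : IsUnitVec β) (hξ : IsUnitVec ξ) (hκ : 0 ≤ κ)
    (hκx : κ * l2norm (β - ξ) ^ 2 ≤ 1 / 2) : IsUnitVec (interpolant κ β ξ) := by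
  have hm := l2norm_lineMap_pos hβ hξ hκ hκx
  rw [IsUnitVec, ← l2norm_sq, interpolant, l2norm_smul, abs_inv, abs_of_pos hm,
    inv_mul_cancel₀ hm.ne', one_pow]

theorem inv_l2norm_lineMap_le (hβ : IsUnitVec β) (hξ : IsUnitVec ξ) (hκ : 0 ≤ κ)
    (hκx : κ * l2norm (β - ξ) ^ 2 ≤ 1 / 2) :
    (l2norm (AffineMap.lineMap β ξ κ))⁻¹ ≤ 1 + 2 * κ * l2norm (β - ξ) ^ 2 := by
  have lower := one_sub_le_l2norm_lineMap hβ hξ hκ (hκx.trans (by norm_num))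
  have hx : 0 ≤ κ * l2norm (β - ξ) ^ 2 := by positivity
  rw [inv_le_iff_one_le_mul₀ (l2norm_lineMap_pos hβ hξ hκ hκx)]
  nlinarith

theorem one_add_le_inv_l2norm_lineMap (hβ : IsUnitVec β) (hξ : IsUnitVec ξ) (hκ : 0 ≤ κ)
    (hκ1 : κ ≤ 1) (hκx : κ * l2norm (β - ξ) ^ 2 ≤ 1 / 2) :
    1 + κ * (1 - κ) * l2norm (β - ξ) ^ 2 / 2 ≤ (l2norm (AffineMap.lineMap β ξ κ))⁻¹ := by
  have hm := l2norm_lineMap_pos hβ hξ hκ hκx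
  have m_sq := l2norm_lineMap_sq hβ hξ κ
  have hy : 0 ≤ κ * (1 - κ) * l2norm (β - ξ) ^ 2 := by
    have := sub_nonneg.2 hκ1
    positivity
  set y := κ * (1 - κ) * l2norm (β - ξ) ^ 2
  rw [← one_div, le_div_iff₀ hm]
  refine abs_le_of_sq_le_sq' ?_ zero_le_one |>.2
  rw [mul_pow, m_sq]
  nlinarith [pow_nonneg hy 3, sq_nonneg y]

theorem l2norm_interpolant_sub_sq_le (hβ : IsUnitVec β) (hξ : IsUnitVec ξ) (hκ : 0 ≤ κ)
    (hκ1 : κ ≤ 1) (hκx : κ * l2norm (β - ξ) ^ 2 ≤ 1 / 2) :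
    l2norm (interpolant κ β ξ - β) ^ 2
      ≤ κ ^ 2 * l2norm (β - ξ) ^ 2 * (1 + l2norm (β - ξ) ^ 2 / 2) := by
  have inner : interpolant κ β ξ ⬝ᵥ β
      = (l2norm (AffineMap.lineMap β ξ κ))⁻¹ * (1 - κ * l2norm (β - ξ) ^ 2 / 2) := by
    rw [interpolant_eq, add_dotProduct, smul_dotProduct, smul_dotProduct, hβ,
      dotProduct_comm ξ β, dotProduct_eq_one_sub hβ hξ, smul_eq_mul, smul_eq_mul]
    ring
  have inv_lower := one_add_le_inv_l2norm_lineMap hβ hξ hκ hκ1 hκx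
  rw [l2norm_sub_sq (isUnitVec_interpolant hβ hξ hκ hκx) hβ, inner]
  set x := l2norm (β - ξ) ^ 2
  have inner_lower := mul_le_mul_of_nonneg_right inv_lower (show 0 ≤ 1 - κ * x / 2 by linarith)
  have : 0 ≤ κ ^ 3 * x ^ 2 := by positivity
  linarith

theorem l2norm_interpolant_sub_le (hβ : IsUnitVec β) (hξ : IsUnitVec ξ) (hκ : 0 ≤ κ)
    (hκ1 : κ ≤ 1 / 2) (hx : l2norm (β - ξ) ^ 2 ≤ 1) :
    l2norm (interpolant κ β ξ - β) ≤ l2norm (β - ξ) := by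
  have hκx : κ * l2norm (β - ξ) ^ 2 ≤ 1 / 2 := by nlinarith [sq_nonneg (l2norm (β - ξ))]
  refine abs_le_of_sq_le_sq' ?_ (l2norm_nonneg _) |>.2
  calc l2norm (interpolant κ β ξ - β) ^ 2
      ≤ κ ^ 2 * l2norm (β - ξ) ^ 2 * (1 + l2norm (β - ξ) ^ 2 / 2) :=
        l2norm_interpolant_sub_sq_le hβ hξ hκ (by linarith) hκx
    _ ≤ (1 / 2) ^ 2 * l2norm (β - ξ) ^ 2 * (1 + 1 / 2) := by gcongr
    _ ≤ l2norm (β - ξ) ^ 2 := by linarith [sq_nonneg (l2norm (β - ξ))]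

theorem l1norm_interpolant_le (hβ : IsUnitVec β) (hξ : IsUnitVec ξ) (hκ : 0 ≤ κ) (hκ1 : κ ≤ 1)
    (hκx : κ * l2norm (β - ξ) ^ 2 ≤ 1 / 2) {B L : ℝ} (hβB : l1norm β ≤ l1norm ξ + B)
    (hL : 0 ≤ L) (hBL : l1norm ξ + (1 - κ / 4) * B ≤ L)
    (hxL : l2norm (β - ξ) ^ 2 * L ≤ 3 / 4 * B) : l1norm (interpolant κ β ξ) ≤ L := by
  have hm := l2norm_lineMap_pos hβ hξ hκ hκx
  rw [interpolant, l1norm_smul, abs_inv, abs_of_pos hm, inv_mul_le_iff₀ hm]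
  calc l1norm (AffineMap.lineMap β ξ κ) ≤ (1 - κ) * l1norm β + κ * l1norm ξ := by
        rw [AffineMap.lineMap_apply_module]
        refine (l1norm_add_le _ _).trans_eq ?_
        rw [l1norm_smul, l1norm_smul, abs_of_nonneg (sub_nonneg.2 hκ1), abs_of_nonneg hκ]
    _ ≤ (1 - κ) * (l1norm ξ + B) + κ * l1norm ξ := by
        have := sub_nonneg.2 hκ1
        gcongr
    _ ≤ (1 - κ * l2norm (β - ξ) ^ 2) * L := by linarith [mul_le_mul_of_nonneg_left hxL hκ]
    _ ≤ l2norm (AffineMap.lineMap β ξ κ) * L := by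
        gcongr
        exact one_sub_le_l2norm_lineMap hβ hξ hκ (hκx.trans (by norm_num))

end Interpolation

section Descent

variable {p : ℕ}

theorem dotProduct_le_of_isMinOn {F : Set (Fin p → ℝ)} {θ b z : Fin p → ℝ}
    (hmin : IsMinOn (fun b => (b - θ) ⬝ᵥ (b - θ)) F b) (hz : z ∈ F) (hb1 : IsUnitVec b)
    (hz1 : IsUnitVec z) : z ⬝ᵥ θ ≤ b ⬝ᵥ θ := by
  have dist_le := isMinOn_iff.1 hmin z hz
  unfold IsUnitVec at hb1 hz1
  simp only [sub_dotProduct, dotProduct_sub, hb1, hz1, dotProduct_comm θ] at dist_le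
  linarith

theorem quad_le_of_gradient_step {A : Matrix (Fin p) (Fin p) ℝ} {M η G a a' : ℝ}
    {ξ β b z : Fin p → ℝ} (hA : A.IsHermitian) (hAM : ∀ u, u ⬝ᵥ A *ᵥ u ≤ M * (u ⬝ᵥ u))
    (hAξ : A *ᵥ ξ = 0) (hη : 0 < η) (hβ : IsUnitVec β) (hb : IsUnitVec b) (hz : IsUnitVec z)
    (hza : z = a • β + a' • ξ) (hstep : η * ((b - z) ⬝ᵥ A *ᵥ β - G) ≤ (b - z) ⬝ᵥ β) :
    b ⬝ᵥ A *ᵥ b ≤ (2 * a - 1) * (β ⬝ᵥ A *ᵥ β) + l2norm (z - β) ^ 2 / η + 2 * G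
      - (1 / η - M) * l2norm (b - β) ^ 2 := by
  have competitor : z ⬝ᵥ A *ᵥ β = a * (β ⬝ᵥ A *ᵥ β) := by
    simp only [hza, add_dotProduct, smul_dotProduct, dotProduct_mulVec_comm_of_isHermitian hA ξ β,
      hAξ, dotProduct_zero, mul_zero, add_zero, smul_eq_mul]
  have curvature := hAM (b - β)
  rw [quad_sub hA, ← l2norm_sq] at curvature
  have inner_eq : (b - z) ⬝ᵥ β = (l2norm (z - β) ^ 2 - l2norm (b - β) ^ 2) / 2 := by
    rw [sub_dotProduct, l2norm_sub_sq hz hβ, l2norm_sub_sq hb hβ]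
    ring
  rw [inner_eq, sub_dotProduct, competitor, ← le_div_iff₀' hη] at hstep
  calc b ⬝ᵥ A *ᵥ b
      ≤ (2 * a - 1) * (β ⬝ᵥ A *ᵥ β) + 2 * ((l2norm (z - β) ^ 2 - l2norm (b - β) ^ 2) / 2 / η)
        + 2 * G + M * l2norm (b - β) ^ 2 := by linarith
    _ = _ := by ring

/-- `β'` is the iterate with bound `L` that follows `β`. -/
def IsProximalStep (Sh Lh : Matrix (Fin p) (Fin p) ℝ) (η L : ℝ) (β β' : Fin p → ℝ) : Prop :=
  β' ∈ feasible p L ∧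
    IsMinOn (fun b => (b - proxTarget Sh Lh η β) ⬝ᵥ (b - proxTarget Sh Lh η β)) (feasible p L) β'

namespace IsPerturbedPair

variable {M γ ρ ε η K κ b L : ℝ} {S Lam Sh Lh : Matrix (Fin p) (Fin p) ℝ}
  {ξ β β' z : Fin p → ℝ}

theorem excess_le_of_isProximalStep (h : IsPerturbedPair M γ ρ ε S Lam Sh Lh ξ) (hM : 0 < M)
    (hη : 0 < η) (hβ : IsUnitVec β) (hK : mixedNorm (l0norm ξ) β ≤ K)
    (hε : 2 * ε * K ^ 2 ≤ 1 / (4 * M)) (hQ : excess ρ S Lam β ≤ 1 / (4 * M))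
    (hstep : IsProximalStep Sh Lh η L β β') (hz : z ∈ feasible p L) {a a' : ℝ}
    (hza : z = a • β + a' • ξ) :
    excess ρ S Lam β' ≤ (2 * a - 1) * excess ρ S Lam β + l2norm (z - β) ^ 2 / η
      + 2 * (3 * ε * K * mixedNorm (l0norm ξ) (β' - z)
        + 2 * M ^ 2 * (excess ρ S Lam β + 2 * ε * K ^ 2) * l2norm (β' - z))
      - (1 / η - M) * l2norm (β' - β) ^ 2 := by
  refine quad_le_of_gradient_step h.excess_posSemidef.isHermitian h.excess_le h.excess_mulVec hη hβ
    hstep.1.1 hz.1 hza ?_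
  have optimality : 0 ≤ (β' - z) ⬝ᵥ proxTarget Sh Lh η β := by
    rw [sub_dotProduct]
    exact sub_nonneg.2 (dotProduct_le_of_isMinOn hstep.2 hz hstep.1.1 hz.1)
  rw [proxTarget_eq (h.abs_rho_div_rayleigh_sub_one_le hM hβ hK hε hQ).1.ne', dotProduct_sub,
    dotProduct_smul, smul_eq_mul] at optimality
  have gradient_err := (abs_le.1 (h.abs_gradient_err_le hM hβ hK hε hQ (β' - z))).1
  exact (mul_le_mul_of_nonneg_left (by linarith) hη.le).trans (sub_nonneg.1 optimality)

theorem interpolant_terms_le (h : IsPerturbedPair M γ ρ ε S Lam Sh Lh ξ) (hM : 0 < M)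
    (hγ : 0 < γ) (hη : 0 < η) (hκ : κ = η * γ / M) (hκ1 : κ ≤ 1 / 2) (hβ : IsUnitVec β)
    (hx : l2norm (β - ξ) ^ 2 ≤ 1) :
    (2 * ((l2norm (AffineMap.lineMap β ξ κ))⁻¹ * (1 - κ)) - 1) * excess ρ S Lam β
        + l2norm (interpolant κ β ξ - β) ^ 2 / η
      ≤ (1 - κ) * excess ρ S Lam β + 5 * κ * l2norm (β - ξ) ^ 2 * excess ρ S Lam β := by
  have hκ0 : 0 < κ := hκ ▸ by positivity
  have hκx : κ * l2norm (β - ξ) ^ 2 ≤ 1 / 2 := by nlinarith [sq_nonneg (l2norm (β - ξ))]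
  have hQ := h.excess_nonneg β
  have gap := h.sub_sq_div_le_excess hγ hβ
  have dist_z := l2norm_interpolant_sub_sq_le hβ h.unit hκ0.le (by linarith) hκx
  have inv_norm := inv_l2norm_lineMap_le hβ h.unit hκ0.le hκx
  have hx0 : 0 ≤ l2norm (β - ξ) ^ 2 := sq_nonneg _
  set Q := excess ρ S Lam β
  set x := l2norm (β - ξ) ^ 2
  have linear_part : (l2norm (AffineMap.lineMap β ξ κ))⁻¹ * (1 - κ) ≤ 1 - κ + 2 * κ * x := by
    nlinarith [mul_le_mul_of_nonneg_right inv_norm (show 0 ≤ 1 - κ by linarith),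
      mul_nonneg (sq_nonneg κ) hx0]
  have quadratic_part : l2norm (interpolant κ β ξ - β) ^ 2 / η ≤ κ * Q * (1 + x) := by
    rw [div_le_iff₀ hη]
    calc l2norm (interpolant κ β ξ - β) ^ 2 ≤ κ ^ 2 * (x * (1 + x / 2)) := by linarith
      _ ≤ κ ^ 2 * ((x - x ^ 2 / 4) * (1 + x)) := by
          refine mul_le_mul_of_nonneg_left ?_ (sq_nonneg κ)
          nlinarith [mul_nonneg (sq_nonneg x) (sub_nonneg.2 hx)]
      _ ≤ κ ^ 2 * (M / γ * Q * (1 + x)) := by gcongr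
      _ = κ * Q * (1 + x) * η := by
          rw [hκ]
          field_simp
  nlinarith [mul_le_mul_of_nonneg_right linear_part hQ]

theorem noise_terms_le (h : IsPerturbedPair M γ ρ ε S Lam Sh Lh ξ) (hs : 0 < l0norm ξ)
    (hK : 0 ≤ K) (hb : 0 ≤ b) (hβ' : l1norm β' ≤ l1norm ξ + b * √(l0norm ξ : ℝ))
    (hz : l1norm z ≤ l1norm ξ + b * √(l0norm ξ : ℝ))
    (hzβ : l2norm (z - β) ≤ l2norm (β - ξ)) :
    2 * (3 * ε * K * mixedNorm (l0norm ξ) (β' - z)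
        + 2 * M ^ 2 * (excess ρ S Lam β + 2 * ε * K ^ 2) * l2norm (β' - z))
      ≤ (54 * K + 8 * M ^ 2 * K ^ 2) * ε * (l2norm (β' - β) + l2norm (β - ξ) + b)
        + 4 * M ^ 2 * excess ρ S Lam β * (l2norm (β' - β) + l2norm (β - ξ)) := by
  have l2norm_le : l2norm (β' - z) ≤ l2norm (β' - β) + l2norm (β - ξ) := by
    have := l2norm_sub_le (β' - β) (z - β)
    rw [sub_sub_sub_cancel_right] at this
    linarith
  have mixedNorm_le : mixedNorm (l0norm ξ) (β' - z)
      ≤ 3 * l2norm (β' - β) + 9 * l2norm (β - ξ) + 2 * b := by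
    have β'_dist := l2norm_add_le (β' - β) (β - ξ)
    have z_dist := l2norm_add_le (z - β) (β - ξ)
    have triangle := mixedNorm_sub_le (l0norm ξ) (β' - ξ) (z - ξ)
    rw [sub_add_sub_cancel] at β'_dist z_dist
    rw [sub_sub_sub_cancel_right] at triangle
    linarith [mixedNorm_sub_le_of_l1norm_le hs hβ', mixedNorm_sub_le_of_l1norm_le hs hz]
  have hQ := h.excess_nonneg β
  have hε := h.err_nonneg
  have hd := l2norm_nonneg (β' - β)
  set Q := excess ρ S Lam β
  set d := l2norm (β' - β)
  set y := l2norm (β - ξ)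
  have : 0 ≤ K * ε * d := by positivity
  have : 0 ≤ K * ε * b := by positivity
  have : 0 ≤ M ^ 2 * K ^ 2 * ε * b := by positivity
  calc 2 * (3 * ε * K * mixedNorm (l0norm ξ) (β' - z)
        + 2 * M ^ 2 * (Q + 2 * ε * K ^ 2) * l2norm (β' - z))
      ≤ 2 * (3 * ε * K * (3 * d + 9 * y + 2 * b)
        + 2 * M ^ 2 * (Q + 2 * ε * K ^ 2) * (d + y)) := by gcongr
    _ ≤ _ := by linarith

theorem excess_step_le (h : IsPerturbedPair M γ ρ ε S Lam Sh Lh ξ) (hM : 0 < M) (hγ : 0 < γ)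
    (hs : 0 < l0norm ξ) (hη : 0 < η) (hκ : κ = η * γ / M) (hκ1 : κ ≤ 1 / 2) (hK : 0 ≤ K)
    (hb : 0 ≤ b) (hβ : IsUnitVec β) (hβK : mixedNorm (l0norm ξ) β ≤ K)
    (hβb : l1norm β ≤ l1norm ξ + b * √(l0norm ξ : ℝ))
    (hLb : L ≤ l1norm ξ + b * √(l0norm ξ : ℝ))
    (hbL : l1norm ξ + (1 - κ / 4) * (b * √(l0norm ξ : ℝ)) ≤ L)
    (hε : 2 * ε * K ^ 2 ≤ 1 / (4 * M)) (hQ : excess ρ S Lam β ≤ 1 / (4 * M))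
    (hx : l2norm (β - ξ) ^ 2 ≤ 1) (hxL : l2norm (β - ξ) ^ 2 * L ≤ 3 / 4 * (b * √(l0norm ξ : ℝ)))
    (hstep : IsProximalStep Sh Lh η L β β') :
    excess ρ S Lam β' ≤ (1 - κ) * excess ρ S Lam β
      + 5 * κ * l2norm (β - ξ) ^ 2 * excess ρ S Lam β
      + ((54 * K + 8 * M ^ 2 * K ^ 2) * ε * (l2norm (β' - β) + l2norm (β - ξ) + b)
        + 4 * M ^ 2 * excess ρ S Lam β * (l2norm (β' - β) + l2norm (β - ξ)))
      - (1 / η - M) * l2norm (β' - β) ^ 2 := by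
  have hκ0 : 0 < κ := hκ ▸ by positivity
  have hκx : κ * l2norm (β - ξ) ^ 2 ≤ 1 / 2 := by nlinarith [sq_nonneg (l2norm (β - ξ))]
  have competitor : interpolant κ β ξ ∈ feasible p L :=
    ⟨isUnitVec_interpolant hβ h.unit hκ0.le hκx,
      l1norm_interpolant_le hβ h.unit hκ0.le (by linarith) hκx hβb
        ((l1norm_nonneg _).trans hstep.1.2) hbL hxL⟩
  have descent := h.excess_le_of_isProximalStep hM hη hβ hβK hε hQ hstep competitor
    (interpolant_eq κ β ξ)
  have noise := h.noise_terms_le hs hK hb (hstep.1.2.trans hLb) (competitor.2.trans hLb)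
    (l2norm_interpolant_sub_le hβ h.unit hκ0.le hκ1 hx)
  linarith [h.interpolant_terms_le hM hγ hη hκ hκ1 hβ hx]

end IsPerturbedPair

end Descent

section Contraction

theorem mul_le_weighted_add_sq {a : ℝ} (ha : 0 < a) (x y : ℝ) :
    x * y ≤ a * x ^ 2 + y ^ 2 / (4 * a) := by
  have : a * x ^ 2 + y ^ 2 / (4 * a) - x * y = a * (x - y / (2 * a)) ^ 2 := by
    field_simp
    ring
  nlinarith [mul_nonneg ha.le (sq_nonneg (x - y / (2 * a)))]

theorem contraction_of_noise_bound {κ c₀ g C₁ C₂ k ε b w Q Q' y d : ℝ} (hκ : 0 < κ)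
    (hc₀ : 0 < c₀) (hg : 0 < g) (hC₂ : 0 < C₂) (hk : 0 < k) (hε : 0 ≤ ε) (hkε : k * ε ≤ b)
    (hw : 2 ≤ w) (hQ : 0 ≤ Q) (hy : y ^ 2 ≤ g * Q) (hQ₁ : g * Q ≤ (c₀ * κ / (4 * C₂)) ^ 2)
    (hQ₂ : 5 * g * Q ≤ c₀ / 4) (hQ₃ : C₂ ^ 2 * Q ≤ c₀ * κ / 4)
    (h : Q' ≤ (1 - κ) * Q + 5 * κ * y ^ 2 * Q + (C₁ * ε * (d + y + b) + C₂ * Q * (d + y))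
      - w * d ^ 2) :
    Q' ≤ (1 - (1 - c₀) * κ) * Q + (C₁ ^ 2 * (1 + g / (c₀ * κ)) / k + C₁) * ε * b := by
  have : 0 < c₀ * κ := mul_pos hc₀ hκ
  have y_le : y ≤ c₀ * κ / (4 * C₂) := (abs_le_of_sq_le_sq' (hy.trans hQ₁) (by positivity)).2
  have noise_d : C₁ * ε * d ≤ d ^ 2 + C₁ ^ 2 * ε ^ 2 := by
    nlinarith [two_mul_le_add_sq (C₁ * ε) d, sq_nonneg (C₁ * ε), sq_nonneg d]
  have noise_y : C₁ * ε * y ≤ c₀ * κ / 4 * Q + C₁ ^ 2 * (g / (c₀ * κ)) * ε ^ 2 := by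
    calc C₁ * ε * y = y * (C₁ * ε) := mul_comm _ _
      _ ≤ c₀ * κ / (4 * g) * y ^ 2 + (C₁ * ε) ^ 2 / (4 * (c₀ * κ / (4 * g))) :=
          mul_le_weighted_add_sq (by positivity) _ _
      _ ≤ c₀ * κ / (4 * g) * (g * Q) + (C₁ * ε) ^ 2 / (4 * (c₀ * κ / (4 * g))) := by gcongr
      _ = _ := by field_simp
  have excess_d : C₂ * Q * d ≤ d ^ 2 + c₀ * κ / 4 * Q := by
    nlinarith [two_mul_le_add_sq (C₂ * Q) d, sq_nonneg d, mul_le_mul_of_nonneg_right hQ₃ hQ,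
      sq_nonneg (C₂ * Q)]
  have excess_y : C₂ * Q * y ≤ c₀ * κ / 4 * Q := by
    calc C₂ * Q * y ≤ C₂ * Q * (c₀ * κ / (4 * C₂)) := by gcongr
      _ = _ := by field_simp
  have curvature : 5 * κ * y ^ 2 * Q ≤ c₀ * κ / 4 * Q :=
    mul_le_mul_of_nonneg_right (by nlinarith) hQ
  have sq_noise : C₁ ^ 2 * (1 + g / (c₀ * κ)) * ε ^ 2
      ≤ C₁ ^ 2 * (1 + g / (c₀ * κ)) * (ε * b / k) := by
    gcongr
    rw [le_div_iff₀ hk]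
    nlinarith
  have : 2 * d ^ 2 ≤ w * d ^ 2 := by gcongr
  have : (C₁ ^ 2 * (1 + g / (c₀ * κ)) / k + C₁) * ε * b
      = C₁ ^ 2 * (1 + g / (c₀ * κ)) * (ε * b / k) + C₁ * ε * b := by ring
  linarith

variable {p : ℕ} {M γ ρ ε η c₀ K κ g C₁ C₂ k b L : ℝ} {S Lam Sh Lh : Matrix (Fin p) (Fin p) ℝ}
  {ξ β β' : Fin p → ℝ}

theorem IsLeadingPair.step_mul_gap_le (h : IsLeadingPair M γ ρ S Lam ξ) (hM : 0 < M) (hη : 0 ≤ η)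
    (hηM : 6 * M * η ≤ 1) : η * γ / M ≤ 1 / 6 := by
  rw [div_le_iff₀ hM]
  nlinarith [h.one_le hM, h.gap_le_one]

theorem IsLeadingPair.step_mul_rate_le (h : IsLeadingPair M γ ρ S Lam ξ) (hM : 0 < M) (hγ : 0 < γ)
    (hc₀ : 0 < c₀) (hη : 0 ≤ η) : η * ((1 - c₀) * γ ^ 2 / M) ≤ η * γ / M := by
  rw [← mul_div_assoc]
  gcongr
  nlinarith [mul_nonneg hγ.le (sub_nonneg.2 h.gap_le_one), mul_pos hc₀ (mul_pos hγ hγ)]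

theorem IsLeadingPair.step_mul_rate_le_one_sub_mul (h : IsLeadingPair M γ ρ S Lam ξ) (hM : 0 < M)
    (hγ : 0 < γ) (hc₀ : c₀ ≤ 1) (hη : 0 ≤ η) :
    η * ((1 - c₀) * γ ^ 2 / M) ≤ (1 - c₀) * (η * γ / M) := by
  have : 0 ≤ (1 - c₀) * (η * γ / M) := mul_nonneg (sub_nonneg.2 hc₀) (by positivity)
  calc η * ((1 - c₀) * γ ^ 2 / M) = (1 - c₀) * (η * γ / M) * γ := by ring
    _ ≤ (1 - c₀) * (η * γ / M) := mul_le_of_le_one_right this h.gap_le_one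

theorem IsPerturbedPair.excess_contraction (h : IsPerturbedPair M γ ρ ε S Lam Sh Lh ξ)
    (hM : 0 < M) (hγ : 0 < γ) (hs : 0 < l0norm ξ) (hc₀ : 0 < c₀) (hc₀' : c₀ < 1) (hη : 0 < η)
    (hηM : 6 * M * η ≤ 1) (hκ : κ = η * γ / M) (hg : g = 2 * M / γ)
    (hC₁ : C₁ = 54 * K + 8 * M ^ 2 * K ^ 2) (hC₂ : C₂ = 4 * M ^ 2) (hK : 0 ≤ K) (hk : 0 < k)
    (hkε : k * ε ≤ b) (hε : 2 * ε * K ^ 2 ≤ 1 / (4 * M)) (hβ : IsUnitVec β)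
    (hβK : mixedNorm (l0norm ξ) β ≤ K) (hβb : l1norm β ≤ l1norm ξ + b * √(l0norm ξ : ℝ))
    (hLK : L ≤ K * √(l0norm ξ : ℝ)) (hLb : L ≤ l1norm ξ + b * √(l0norm ξ : ℝ))
    (hbL : l1norm ξ + (1 - κ / 4) * (b * √(l0norm ξ : ℝ)) ≤ L)
    (hQ₁ : g * excess ρ S Lam β ≤ (c₀ * κ / (4 * C₂)) ^ 2)
    (hQ₂ : 5 * g * excess ρ S Lam β ≤ c₀ / 4) (hQ₃ : C₂ ^ 2 * excess ρ S Lam β ≤ c₀ * κ / 4)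
    (hQ₄ : excess ρ S Lam β ≤ 1 / (4 * M)) (hQ₅ : g * K * excess ρ S Lam β ≤ 3 / 4 * b)
    (hstep : IsProximalStep Sh Lh η L β β') :
    excess ρ S Lam β' ≤ (1 - (1 - c₀) * κ) * excess ρ S Lam β
      + (C₁ ^ 2 * (1 + g / (c₀ * κ)) / k + C₁) * ε * b := by
  wlog hsign : 0 ≤ β ⬝ᵥ ξ generalizing ξ
  · rw [← l0norm_neg ξ] at hs hβK hβb hLK hLb hbL
    rw [← l1norm_neg ξ] at hβb hLb hbL
    exact this h.neg hs hβK hβb hLK hLb hbL (by rw [dotProduct_neg]; linarith)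
  have hM1 := h.one_le hM
  have hQ := h.excess_nonneg β
  have hκ0 : 0 < κ := hκ ▸ by positivity
  have hκ1 : κ ≤ 1 / 6 := hκ ▸ h.step_mul_gap_le hM hη.le hηM
  have hb : 0 ≤ b := (mul_nonneg hk.le h.err_nonneg).trans hkε
  have hL : 0 ≤ L := (l1norm_nonneg _).trans hstep.1.2
  have hη6 : 6 * M ≤ 1 / η := by rwa [le_div_iff₀ hη]
  have dist_sq : l2norm (β - ξ) ^ 2 ≤ g * excess ρ S Lam β :=
    hg ▸ h.l2norm_sub_sq_le_excess hγ hβ hsign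
  have dist_sq_mul : l2norm (β - ξ) ^ 2 * L ≤ 3 / 4 * (b * √(l0norm ξ : ℝ)) := by
    calc l2norm (β - ξ) ^ 2 * L ≤ g * excess ρ S Lam β * (K * √(l0norm ξ : ℝ)) :=
          mul_le_mul dist_sq hLK hL ((sq_nonneg _).trans dist_sq)
      _ = g * K * excess ρ S Lam β * √(l0norm ξ : ℝ) := by ring
      _ ≤ 3 / 4 * b * √(l0norm ξ : ℝ) := by gcongr
      _ = _ := mul_assoc _ _ _
  have step := h.excess_step_le hM hγ hs hη hκ (by linarith) hK hb hβ hβK hβb hLb hbL hε hQ₄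
    (by linarith) dist_sq_mul hstep
  rw [← hC₁, ← hC₂] at step
  exact contraction_of_noise_bound hκ0 hc₀ (hg ▸ by positivity) (hC₂ ▸ by positivity) hk
    h.err_nonneg hkε (by linarith) hQ dist_sq hQ₁ hQ₂ hQ₃ step

theorem eventually_mul_le (c : ℝ) {e : ℝ} (he : 0 < e) :
    ∀ᶠ q in nhdsWithin (0 : ℝ) (Set.Ioi 0), c * q ≤ e := by
  have : Filter.Tendsto (fun q : ℝ => c * q) (nhds 0) (nhds (c * 0)) :=
    (continuous_const_mul c).tendsto 0
  rw [mul_zero] at this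
  exact (this.mono_left nhdsWithin_le_nhds).eventually_le_const he

theorem exists_excess_step {c : ℝ} (hM : 0 < M) (hγ : 0 < γ) (hc₀ : 0 < c₀) (hc₀' : c₀ < 1)
    (hη : 0 < η) (hηM : 6 * M * η ≤ 1) (hc : 0 ≤ c) (hk : 0 < k) :
    ∃ q₀ > 0, ∃ ε₀ > 0, ∃ A > 0,
    ∀ {p : ℕ} {ρ ε b L : ℝ} {S Lam Sh Lh : Matrix (Fin p) (Fin p) ℝ} {ξ β β' : Fin p → ℝ},
    IsPerturbedPair M γ ρ ε S Lam Sh Lh ξ → 0 < l0norm ξ → ε ≤ ε₀ → k * ε ≤ b →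
    IsUnitVec β → l1norm β ≤ l1norm ξ + b * √(l0norm ξ : ℝ) →
    l1norm ξ + b * √(l0norm ξ : ℝ) ≤ c * √(l0norm ξ : ℝ) →
    L ≤ l1norm ξ + b * √(l0norm ξ : ℝ) →
    l1norm ξ + (1 - η * γ / M / 4) * (b * √(l0norm ξ : ℝ)) ≤ L →
    excess ρ S Lam β ≤ q₀ → excess ρ S Lam β ≤ q₀ * b →
    IsProximalStep Sh Lh η L β β' →
    excess ρ S Lam β' ≤ (1 - η * ((1 - c₀) * γ ^ 2 / M)) * excess ρ S Lam β + A * ε * b := by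
  obtain ⟨κ, hκ⟩ : ∃ κ, κ = η * γ / M := ⟨_, rfl⟩
  obtain ⟨g, hg⟩ : ∃ g, g = 2 * M / γ := ⟨_, rfl⟩
  obtain ⟨C₁, hC₁⟩ : ∃ C₁, C₁ = 54 * (1 + c) + 8 * M ^ 2 * (1 + c) ^ 2 := ⟨_, rfl⟩
  obtain ⟨C₂, hC₂⟩ : ∃ C₂, C₂ = 4 * M ^ 2 := ⟨_, rfl⟩
  have hκ0 : 0 < κ := hκ ▸ by positivity
  have hg0 : 0 < g := hg ▸ by positivity
  have hC₁0 : 0 < C₁ := hC₁ ▸ by positivity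
  have hC₂0 : 0 < C₂ := hC₂ ▸ by positivity
  obtain ⟨q₀, ⟨⟨⟨⟨⟨hq₁, hq₂⟩, hq₃⟩, hq₄⟩, hq₅⟩, hq₀ : 0 < q₀⟩⟩ :=
    (((((eventually_mul_le g (e := (c₀ * κ / (4 * C₂)) ^ 2) (by positivity)).and
      (eventually_mul_le (5 * g) (e := c₀ / 4) (by positivity))).and
      (eventually_mul_le (C₂ ^ 2) (e := c₀ * κ / 4) (by positivity))).and
      (eventually_mul_le 1 (e := 1 / (4 * M)) (by positivity))).and
      (eventually_mul_le (g * (1 + c)) (e := 3 / 4) (by positivity))).and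
      self_mem_nhdsWithin |>.exists
  refine ⟨q₀, hq₀, 1 / (4 * M) / (2 * (1 + c) ^ 2), by positivity,
    C₁ ^ 2 * (1 + g / (c₀ * κ)) / k + C₁, by positivity, ?_⟩
  intro p ρ ε b L S Lam Sh Lh ξ β β' h hs hε hkε hβ hβb hbc hLb hbL hQ hQb hstep
  rw [le_div_iff₀ (by positivity)] at hε
  rw [← hκ] at hbL
  have hb : 0 ≤ b := (mul_nonneg hk.le h.err_nonneg).trans hkε
  have scaled {a e : ℝ} (ha : 0 ≤ a) (hq : a * q₀ ≤ e) : a * excess ρ S Lam β ≤ e :=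
    (mul_le_mul_of_nonneg_left hQ ha).trans hq
  have contraction := h.excess_contraction hM hγ hs hc₀ hc₀' hη hηM hκ hg hC₁ hC₂ (by positivity)
    hk hkε (by linarith) hβ (hβ.mixedNorm_le hs (hβb.trans hbc)) hβb
    (by nlinarith [Real.sqrt_nonneg (l0norm ξ : ℝ)]) hLb hbL (scaled hg0.le hq₁)
    (scaled (by positivity) hq₂) (scaled (by positivity) hq₃) (by linarith)
    (by nlinarith [mul_le_mul_of_nonneg_right hq₅ hb,
      mul_le_mul_of_nonneg_left hQb (show 0 ≤ g * (1 + c) by positivity)]) hstep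
  have weaken : (1 - (1 - c₀) * κ) * excess ρ S Lam β
      ≤ (1 - η * ((1 - c₀) * γ ^ 2 / M)) * excess ρ S Lam β := by
    have := h.step_mul_rate_le_one_sub_mul hM hγ hc₀'.le hη.le
    rw [← hκ] at this
    exact mul_le_mul_of_nonneg_right (by linarith) (h.excess_nonneg β)
  linarith

end Contraction

section Recursion

variable {ω A ε q₀ a c : ℝ} {q b : ℕ → ℝ} {T : ℕ}

theorem one_sub_pow_mul_le (hω : 0 ≤ ω) (hω1 : ω ≤ 1) (ha : a ≤ b 0)
    (hb : ∀ t ≤ T, 0 ≤ b t) (hdecay : ∀ t < T, (1 - ω / 4) * b t ≤ b (t + 1)) :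
    ∀ t ≤ T, (1 - ω) ^ t * a ≤ b t := by
  intro t
  induction t with
  | zero =>
    intro _
    rwa [pow_zero, one_mul]
  | succ t ih =>
    intro ht
    rw [pow_succ]
    nlinarith [ih (by omega), hdecay t (by omega), hb t (by omega)]

theorem recursion_bound (hω : 0 < ω) (hω1 : ω ≤ 1) (hA : 0 < A) (hε : 0 ≤ ε) (hq₀ : 0 < q₀)
    (ha : a ≤ b 0) (hbc : ∀ t, b t ≤ c) (hb : ∀ t ≤ T, 0 ≤ b t)
    (hdecay : ∀ t < T, (1 - ω / 4) * b t ≤ b (t + 1)) (hq : q 0 ≤ q₀ / 2)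
    (hqa : q 0 ≤ q₀ / 2 * a) (hεc : 2 * A / ω * ε * c ≤ q₀ / 2) (hε1 : 2 * A / ω * ε ≤ q₀ / 2)
    (hstep : ∀ t < T, q t ≤ q₀ → q t ≤ q₀ * b t → q (t + 1) ≤ (1 - ω) * q t + A * ε * b t) :
    ∀ t ≤ T, q t ≤ (1 - ω) ^ t * q 0 + 2 * A / ω * ε * b t := by
  have lower_bound := one_sub_pow_mul_le hω.le hω1 ha hb hdecay
  have hAε : 0 ≤ 2 * A / ω * ε := by positivity
  intro t
  induction t with
  | zero =>
    intro h0
    simpa only [pow_zero, one_mul, le_add_iff_nonneg_right] using mul_nonneg hAε (hb 0 h0)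
  | succ t ih =>
    intro ht
    have bound_t := ih (by omega)
    have hbt := hb t (by omega)
    have hpow1 : (1 - ω) ^ t ≤ 1 := pow_le_one₀ (by linarith) (by linarith)
    have hpow0 : 0 ≤ (1 - ω) ^ t := pow_nonneg (by linarith) t
    have small : q t ≤ q₀ := by
      nlinarith [mul_le_mul_of_nonneg_left (hbc t) hAε]
    have small_relative : q t ≤ q₀ * b t := by
      have : (1 - ω) ^ t * q 0 ≤ q₀ / 2 * b t := by
        calc (1 - ω) ^ t * q 0 ≤ (1 - ω) ^ t * (q₀ / 2 * a) := by gcongr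
          _ = q₀ / 2 * ((1 - ω) ^ t * a) := by ring
          _ ≤ q₀ / 2 * b t := by
            gcongr
            exact lower_bound t (by omega)
      linarith [mul_le_mul_of_nonneg_right hε1 hbt]
    have step := hstep t (by omega) small small_relative
    have forcing : (1 - ω) * (2 * A / ω * ε * b t) + A * ε * b t ≤ 2 * A / ω * ε * b (t + 1) := by
      have : 2 * A / ω * ε * ((1 - ω / 4) * b t)
          = (1 - ω) * (2 * A / ω * ε * b t) + 3 / 2 * (A * ε * b t) := by
        field_simp
        ring
      have : 0 ≤ A * ε * b t := by positivity
      linarith [mul_le_mul_of_nonneg_left (hdecay t (by omega)) hAε]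
    rw [pow_succ]
    linarith [mul_le_mul_of_nonneg_left bound_t (show 0 ≤ 1 - ω by linarith)]

end Recursion

section Schedule

variable {p : ℕ}

/-- The normalized slack `B_t / √s` of the `ℓ₁` bound `L t` over `‖ξ‖₁`. -/
noncomputable def slack (ξ : Fin p → ℝ) (L : ℕ → ℝ) (t : ℕ) : ℝ :=
  (L t - l1norm ξ) / √(l0norm ξ : ℝ)

theorem l1norm_add_slack_mul {ξ : Fin p → ℝ} (hs : 0 < l0norm ξ) (L : ℕ → ℝ) (t : ℕ) :
    l1norm ξ + slack ξ L t * √(l0norm ξ : ℝ) = L t := by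
  rw [slack, div_mul_cancel₀ _ (by positivity), add_sub_cancel]

theorem slack_antitone {L : ℕ → ℝ} (hL : Antitone L) (ξ : Fin p → ℝ) : Antitone (slack ξ L) := by
  intro i j hij
  have := hL hij
  unfold slack
  gcongr

theorem IsProximalRun.mem_feasible {Sh Lh : Matrix (Fin p) (Fin p) ℝ} {η : ℝ} {L : ℕ → ℝ}
    {β : ℕ → Fin p → ℝ} (hrun : IsProximalRun Sh Lh η L β) (h0 : β 0 ∈ feasible p (L 0)) (t : ℕ) :
    β t ∈ feasible p (L t) := by
  cases t with
  | zero => exact h0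
  | succ t => exact (hrun t).1

theorem exists_excess_bound {M γ c₀ η c k a : ℝ} (hM : 0 < M) (hγ : 0 < γ) (hc₀ : 0 < c₀)
    (hc₀' : c₀ < 1) (hη : 0 < η) (hηM : 6 * M * η ≤ 1) (hc : 0 ≤ c) (hk : 0 < k) (ha : 0 < a) :
    ∃ q₀ > 0, ∃ ε₀ > 0, ∃ A > 0,
    ∀ {p : ℕ} {ρ ε : ℝ} {S Lam Sh Lh : Matrix (Fin p) (Fin p) ℝ} {ξ : Fin p → ℝ}
      {L : ℕ → ℝ} {β : ℕ → Fin p → ℝ} {T : ℕ},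
    IsPerturbedPair M γ ρ ε S Lam Sh Lh ξ → 0 < l0norm ξ → ε ≤ ε₀ → Antitone L →
    L 0 ≤ c * √(l0norm ξ : ℝ) → a ≤ slack ξ L 0 → (∀ t ≤ T, k * ε ≤ slack ξ L t) →
    (∀ t < T, (1 - η * ((1 - c₀) * γ ^ 2 / M) / 4) * slack ξ L t ≤ slack ξ L (t + 1)) →
    β 0 ∈ feasible p (L 0) → excess ρ S Lam (β 0) ≤ q₀ → IsProximalRun Sh Lh η L β →
    ∀ t ≤ T, excess ρ S Lam (β t)
      ≤ (1 - η * ((1 - c₀) * γ ^ 2 / M)) ^ t * excess ρ S Lam (β 0) + A * ε * slack ξ L t := by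
  obtain ⟨q₀, hq₀, ε₀, hε₀, A, hA, excess_step⟩ :=
    exists_excess_step hM hγ hc₀ hc₀' hη hηM hc hk
  obtain ⟨ω, hω⟩ : ∃ ω, ω = η * ((1 - c₀) * γ ^ 2 / M) := ⟨_, rfl⟩
  have hω0 : 0 < ω := by
    have := sub_pos.2 hc₀'
    rw [hω]
    positivity
  refine ⟨min (q₀ / 2) (q₀ / 2 * a), by positivity,
    min ε₀ (q₀ / 2 / (2 * A / ω * (1 + c))), by positivity, 2 * A / ω, by positivity, ?_⟩
  intro p ρ ε S Lam Sh Lh ξ L β T h hs hε hL hL0 ha0 hkε hdecay hβ0 hQ hrun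
  obtain ⟨hε, hεc⟩ := le_min_iff.1 hε
  obtain ⟨hQ, hQa⟩ := le_min_iff.1 hQ
  rw [le_div_iff₀ (by positivity)] at hεc
  rw [← hω] at hdecay ⊢
  have hε0 := h.err_nonneg
  have hAε : 0 ≤ 2 * A / ω * ε := by positivity
  have slack_nonneg t (ht : t ≤ T) : 0 ≤ slack ξ L t := (by positivity : 0 ≤ k * ε).trans (hkε t ht)
  have slack_le t : slack ξ L t ≤ c := by
    rw [slack, div_le_iff₀ (by positivity)]
    linarith [hL t.zero_le, l1norm_nonneg ξ]
  have hωκ : ω ≤ η * γ / M := hω ▸ h.step_mul_rate_le hM hγ hc₀ hη.le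
  have hκ1 := h.step_mul_gap_le hM hη.le hηM
  refine recursion_bound hω0 (by linarith) hA hε0 hq₀ ha0 slack_le slack_nonneg hdecay hQ hQa
    (by nlinarith) (by nlinarith) fun t ht hQt hQb => ?_
  have decay_le : (1 - η * γ / M / 4) * slack ξ L t ≤ slack ξ L (t + 1) :=
    le_trans (mul_le_mul_of_nonneg_right (by linarith) (slack_nonneg t ht.le)) (hdecay t ht)
  have hβt := hrun.mem_feasible hβ0 t
  rw [hω]
  refine excess_step h hs hε (hkε t ht.le) hβt.1 ?_ ?_ ?_ ?_ hQt hQb (hrun t)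
  · exact (l1norm_add_slack_mul hs L t).symm ▸ hβt.2
  · exact (l1norm_add_slack_mul hs L t).symm ▸ (hL t.zero_le).trans hL0
  · exact (l1norm_add_slack_mul hs L t).symm ▸ hL t.le_succ
  · rw [← l1norm_add_slack_mul hs L (t + 1), ← mul_assoc]
    gcongr

variable {c₁ c₂ η Linf : ℝ} {s n : ℕ}

theorem rate_nonneg (s p n : ℕ) : 0 ≤ rate s p n := by
  have : 0 ≤ Real.log p := Real.log_natCast_nonneg p
  unfold rate
  positivity

theorem bound_zero (c₁ c₂ η Linf : ℝ) (s p n : ℕ) :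
    bound c₁ c₂ η Linf s p n 0 = (1 + c₁) * √(s : ℝ) := by
  rw [bound, pow_zero, one_mul, add_sub_cancel]

theorem bound_antitone (hc : 0 ≤ c₂ * η) (hr : c₂ * η * √(rate s p n) ≤ 1)
    (hL : Linf ≤ (1 + c₁) * √(s : ℝ)) : Antitone (bound c₁ c₂ η Linf s p n) := by
  have : 0 ≤ c₂ * η * √(rate s p n) := mul_nonneg hc (Real.sqrt_nonneg _)
  intro a b hab
  unfold bound
  gcongr Linf + ?_ * _
  exact pow_le_pow_of_le_one (by linarith) (by linarith) hab

theorem bound_sub_bound_succ_le (hc : 0 ≤ c₂ * η) (hr : c₂ * η * √(rate s p n) ≤ 1)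
    (hL0 : 0 ≤ Linf) (hL : Linf ≤ (1 + c₁) * √(s : ℝ)) (t : ℕ) :
    bound c₁ c₂ η Linf s p n t - bound c₁ c₂ η Linf s p n (t + 1)
      ≤ c₂ * η * √(rate s p n) * ((1 + c₁) * √(s : ℝ)) := by
  have hτ : 0 ≤ c₂ * η * √(rate s p n) := mul_nonneg hc (Real.sqrt_nonneg _)
  have hpow : (1 - c₂ * η * √(rate s p n)) ^ t ≤ 1 := pow_le_one₀ (by linarith) (by linarith)
  have : 0 ≤ (1 + c₁) * √(s : ℝ) - Linf := sub_nonneg.2 hL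
  calc bound c₁ c₂ η Linf s p n t - bound c₁ c₂ η Linf s p n (t + 1)
      = (1 - c₂ * η * √(rate s p n)) ^ t * (c₂ * η * √(rate s p n))
          * ((1 + c₁) * √(s : ℝ) - Linf) := by
        rw [bound, bound, pow_succ]
        ring
    _ ≤ 1 * (c₂ * η * √(rate s p n)) * ((1 + c₁) * √(s : ℝ)) := by
        gcongr
        linarith
    _ = _ := by rw [one_mul]

theorem sqrt_sq_mul_log_div (s p n : ℕ) :
    √((s : ℝ) ^ 2 * Real.log p / n) = √(s : ℝ) * √(rate s p n) := by
  rw [← Real.sqrt_mul s.cast_nonneg, rate]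
  ring_nf

theorem threshold_le_of_le_stopTime {ν : ℝ} {t : ℕ} {B : ℕ → ℝ} (hB : Antitone B) (ht : 0 < t)
    (h : (t : ℕ∞) ≤ stopTime c₁ c₂ ν s p n B) :
    4 * c₂ * (1 + c₁) / ν * (√(s : ℝ) * √(rate s p n)) ≤ B t := by
  have pred_lt : ((t - 1 : ℕ) : ℕ∞) < stopTime c₁ c₂ ν s p n B :=
    lt_of_lt_of_le (by exact_mod_cast Nat.sub_lt ht one_pos) h
  obtain ⟨t', h'⟩ := lt_iSup_iff.1 pred_lt
  obtain ⟨threshold_le, lt_t'⟩ := lt_iSup_iff.1 h'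
  rw [← sqrt_sq_mul_log_div]
  exact threshold_le.trans (hB (Nat.le_of_pred_lt (by exact_mod_cast lt_t')))

end Schedule

section Discrepancy

variable {p : ℕ} {M γ ρ : ℝ} {S Lam : Matrix (Fin p) (Fin p) ℝ} {ξ β : Fin p → ℝ}

theorem IsUnitVec.l0norm_pos (h : IsUnitVec ξ) : 0 < l0norm ξ := by
  have : ξ ≠ 0 := by
    rintro rfl
    simp [IsUnitVec] at h
  obtain ⟨i, hi⟩ := Function.ne_iff.1 this
  exact (Set.ncard_pos (Set.toFinite _)).2 ⟨i, hi⟩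

theorem IsUnitVec.abs_dotProduct_le_one (hβ : IsUnitVec β) (hξ : IsUnitVec ξ) :
    |β ⬝ᵥ ξ| ≤ 1 := by
  have sub := l2norm_sub_sq hβ hξ
  have add := l2norm_sub_sq hβ (show IsUnitVec (-ξ) by rwa [IsUnitVec, neg_dotProduct_neg])
  rw [dotProduct_neg] at add
  rw [abs_le]
  constructor <;> linarith [sq_nonneg (l2norm (β - ξ)), sq_nonneg (l2norm (β - -ξ))]

theorem disc_nonneg (hβ : IsUnitVec β) (hξ : IsUnitVec ξ) : 0 ≤ disc ξ β :=
  sub_nonneg.2 (hβ.abs_dotProduct_le_one hξ)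

theorem IsLeadingPair.excess_le_disc (h : IsLeadingPair M γ ρ S Lam ξ) (hβ : IsUnitVec β) :
    excess ρ S Lam β ≤ 2 * M * disc ξ β := by
  wlog hsign : 0 ≤ β ⬝ᵥ ξ generalizing ξ
  · have := this h.neg (by rw [dotProduct_neg]; linarith)
    rwa [disc, dotProduct_neg, abs_neg, ← disc] at this
  calc excess ρ S Lam β = excess ρ S Lam (β - ξ) := (h.excess_sub β).symm
    _ ≤ M * ((β - ξ) ⬝ᵥ (β - ξ)) := h.excess_le _
    _ = 2 * M * disc ξ β := by
      rw [← l2norm_sq, l2norm_sub_sq hβ h.unit, disc, abs_of_nonneg hsign]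
      ring

theorem IsLeadingPair.disc_le_excess (h : IsLeadingPair M γ ρ S Lam ξ) (hγ : 0 < γ)
    (hβ : IsUnitVec β) : disc ξ β ≤ M / γ * excess ρ S Lam β := by
  have hdisc : disc ξ β ≤ 1 - (β ⬝ᵥ ξ) ^ 2 := by
    rw [disc, ← sq_abs]
    nlinarith [abs_nonneg (β ⬝ᵥ ξ), hβ.abs_dotProduct_le_one h.unit]
  rw [div_mul_eq_mul_div, le_div_iff₀' hγ]
  exact (mul_le_mul_of_nonneg_left hdisc hγ.le).trans (h.gap β hβ)

theorem IsLeadingPair.disc_le_of_excess_le (h : IsLeadingPair M γ ρ S Lam ξ) (hM : 0 < M)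
    (hγ : 0 < γ) {β₀ : Fin p → ℝ} (hβ₀ : IsUnitVec β₀) (hβ : IsUnitVec β) {τ A r R b : ℝ}
    (hτ : 0 ≤ τ) (hA : 0 ≤ A) (hr : 0 ≤ r) (hR : 0 ≤ R) (hb : 0 ≤ b)
    (hexcess : excess ρ S Lam β ≤ τ * excess ρ S Lam β₀ + A * r * b) :
    disc ξ β ≤ M / γ * (2 * M + A) * (disc ξ β₀ * τ + R + r * (b + b ^ 2)) := by
  have hδ := disc_nonneg hβ₀ h.unit
  calc disc ξ β ≤ M / γ * excess ρ S Lam β := h.disc_le_excess hγ hβ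
    _ ≤ M / γ * (τ * (2 * M * disc ξ β₀) + A * r * b) := by
      gcongr
      exact hexcess.trans (by gcongr; exact h.excess_le_disc hβ₀)
    _ ≤ M / γ * ((2 * M + A) * (disc ξ β₀ * τ + R + r * (b + b ^ 2))) := by
      gcongr
      have : 0 ≤ A * (disc ξ β₀ * τ) := by positivity
      have : 0 ≤ (2 * M + A) * (R + r * b ^ 2) := by positivity
      have : 0 ≤ M * (r * b) := by positivity
      linarith
    _ = _ := (mul_assoc _ _ _).symm

end Discrepancy

section Run

variable {p n : ℕ} {c₁ c₂ η Linf : ℝ} {ξ : Fin p → ℝ} {L : ℕ → ℝ}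

theorem le_slack_bound_zero (hξ : IsUnitVec ξ) (c₁ c₂ η Linf : ℝ) (n : ℕ) :
    c₁ ≤ slack ξ (bound c₁ c₂ η Linf (l0norm ξ) p n) 0 := by
  have hs : (0 : ℝ) < l0norm ξ := Nat.cast_pos.2 hξ.l0norm_pos
  have := l1norm_le_sqrt_l0norm ξ
  rw [hξ.l2norm_eq_one] at this
  rw [slack, le_div_iff₀ (by positivity), bound_zero]
  linarith

theorem slack_bound_sub_succ_le (hξ : IsUnitVec ξ) (hc : 0 ≤ c₂ * η)
    (hr : c₂ * η * √(rate (l0norm ξ) p n) ≤ 1) (hL0 : 0 ≤ Linf)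
    (hL : Linf ≤ (1 + c₁) * √(l0norm ξ : ℝ)) (t : ℕ) :
    slack ξ (bound c₁ c₂ η Linf (l0norm ξ) p n) t
        - slack ξ (bound c₁ c₂ η Linf (l0norm ξ) p n) (t + 1)
      ≤ c₂ * η * √(rate (l0norm ξ) p n) * (1 + c₁) := by
  have hs : (0 : ℝ) < l0norm ξ := Nat.cast_pos.2 hξ.l0norm_pos
  rw [slack, slack, ← sub_div, sub_sub_sub_cancel_right, div_le_iff₀ (by positivity), mul_assoc]
  exact bound_sub_bound_succ_le hc hr hL0 hL t

theorem slack_bound_decay {ν : ℝ} (hξ : IsUnitVec ξ) (hν : 0 < ν) (hη : 0 ≤ η) (hc₂ : 0 ≤ c₂)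
    (hr : c₂ * η * √(rate (l0norm ξ) p n) ≤ 1) (hL0 : 0 ≤ Linf)
    (hL : Linf ≤ (1 + c₁) * √(l0norm ξ : ℝ)) {t : ℕ}
    (ht : 4 * c₂ * (1 + c₁) / ν * √(rate (l0norm ξ) p n)
      ≤ slack ξ (bound c₁ c₂ η Linf (l0norm ξ) p n) t) :
    (1 - η * ν / 4) * slack ξ (bound c₁ c₂ η Linf (l0norm ξ) p n) t
      ≤ slack ξ (bound c₁ c₂ η Linf (l0norm ξ) p n) (t + 1) := by
  have step := slack_bound_sub_succ_le hξ (by positivity) hr hL0 hL t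
  have : η * ν / 4 * (4 * c₂ * (1 + c₁) / ν * √(rate (l0norm ξ) p n))
      = c₂ * η * √(rate (l0norm ξ) p n) * (1 + c₁) := by
    field_simp
  linarith [mul_le_mul_of_nonneg_left ht (show 0 ≤ η * ν / 4 by positivity)]

theorem threshold_le_slack {ν : ℝ} {t : ℕ} (hξ : IsUnitVec ξ) (hL : Antitone L)
    (h0 : 4 * c₂ * (1 + c₁) / ν * √(rate (l0norm ξ) p n) ≤ slack ξ L 0)
    (ht : (t : ℕ∞) ≤ stopTime c₁ c₂ ν (l0norm ξ) p n fun t => L t - l1norm ξ) :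
    ∀ j ≤ t, 4 * c₂ * (1 + c₁) / ν * √(rate (l0norm ξ) p n) ≤ slack ξ L j := by
  have hs : (0 : ℝ) < l0norm ξ := Nat.cast_pos.2 hξ.l0norm_pos
  intro j hj
  refine le_trans ?_ (slack_antitone hL ξ hj)
  rcases t.eq_zero_or_pos with rfl | ht0
  · exact h0
  · rw [slack, le_div_iff₀ (by positivity), mul_right_comm, mul_assoc]
    exact threshold_le_of_le_stopTime (fun i j hij => sub_le_sub_right (hL hij) _) ht0 ht

theorem exists_disc_bound {M γ c₀ ν K : ℝ} (hM : 0 < M) (hγ : 0 < γ) (hc₀ : 0 < c₀)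
    (hc₀' : c₀ < 1) (hν : ν = (1 - c₀) * γ ^ 2 / M) (hη : 0 < η) (hηM : 6 * M * η ≤ 1)
    (hc₁ : 0 < c₁) (hc₂ : 0 < c₂) (hK : 0 < K) :
    ∃ ψ₁ > 0, ∃ ψ₂ > 0, ∃ r₁ > 0,
    ∀ {p n : ℕ} {ρ Linf : ℝ} {S Lam Sh Lh : Matrix (Fin p) (Fin p) ℝ} {ξ : Fin p → ℝ}
      {L B : ℕ → ℝ} {β : ℕ → Fin p → ℝ},
    IsPerturbedPair M γ ρ (K * √(rate (l0norm ξ) p n)) S Lam Sh Lh ξ →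
    √(rate (l0norm ξ) p n) ≤ r₁ → 0 ≤ Linf → Linf ≤ (1 + c₁) * √(l0norm ξ : ℝ) →
    L = bound c₁ c₂ η Linf (l0norm ξ) p n → (B = fun t => L t - l1norm ξ) →
    β 0 ∈ feasible p (L 0) → disc ξ (β 0) ≤ ψ₁ → IsProximalRun Sh Lh η L β →
    ∀ t : ℕ, (t : ℕ∞) ≤ stopTime c₁ c₂ ν (l0norm ξ) p n B →
      disc ξ (β t) ≤ ψ₂ * (disc ξ (β 0) * (1 - η * ν) ^ t + rate (l0norm ξ) p n
        + √(rate (l0norm ξ) p n) * (B t / √(l0norm ξ : ℝ) + B t ^ 2 / (l0norm ξ : ℝ))) := by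
  have hν0 : 0 < ν := by
    have := sub_pos.2 hc₀'
    rw [hν]
    positivity
  obtain ⟨k, hk⟩ : ∃ k, k = 4 * c₂ * (1 + c₁) / ν := ⟨_, rfl⟩
  have hk0 : 0 < k := hk ▸ by positivity
  obtain ⟨q₀, hq₀, ε₀, hε₀, A, hA, excess_bound⟩ :=
    exists_excess_bound (c := 1 + c₁) hM hγ hc₀ hc₀' hη hηM (by positivity) (div_pos hk0 hK) hc₁
  rw [← hν] at excess_bound
  refine ⟨q₀ / (2 * M), by positivity, M / γ * (2 * M + A * K), by positivity,
    min (ε₀ / K) (min (1 / (c₂ * η)) (c₁ / k)), by positivity, ?_⟩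
  rintro p n ρ Linf S Lam Sh Lh ξ L B β h hr hLinf0 hLinf hLdef rfl hβ0 hδ hrun t ht
  simp only [le_min_iff, le_div_iff₀ hK, le_div_iff₀ hk0, le_div_iff₀ (mul_pos hc₂ hη)] at hr
  obtain ⟨hrε, hrη, hrk⟩ := hr
  rw [le_div_iff₀' (by positivity)] at hδ
  have hcη : 0 ≤ c₂ * η := by positivity
  have hL : Antitone L := hLdef ▸ bound_antitone hcη (by linarith) hLinf
  have hslack0 : c₁ ≤ slack ξ L 0 := hLdef ▸ le_slack_bound_zero h.unit c₁ c₂ η Linf n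
  have threshold := threshold_le_slack h.unit hL (by rw [← hk]; linarith) ht
  have decay j (hj : j < t) : (1 - η * ν / 4) * slack ξ L j ≤ slack ξ L (j + 1) :=
    hLdef ▸ slack_bound_decay h.unit hν0 hη.le hc₂.le (by linarith) hLinf0 hLinf
      (hLdef ▸ threshold j hj.le)
  rw [← hk] at threshold
  have excess_t := excess_bound h h.unit.l0norm_pos (by linarith) hL (hLdef ▸ bound_zero ..).le
    hslack0 (fun j hj => by rw [← mul_assoc, div_mul_cancel₀ _ hK.ne']; exact threshold j hj)
    decay hβ0 ((h.excess_le_disc hβ0.1).trans hδ) hrun t le_rfl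
  have hω1 : 0 ≤ 1 - η * ν := by
    rw [hν]
    linarith [h.step_mul_rate_le hM hγ hc₀ hη.le, h.step_mul_gap_le hM hη.le hηM]
  have slack_sq : (L t - l1norm ξ) ^ 2 / (l0norm ξ : ℝ) = slack ξ L t ^ 2 := by
    rw [slack, div_pow, Real.sq_sqrt (Nat.cast_nonneg _)]
  rw [slack_sq]
  exact h.disc_le_of_excess_le (A := A * K) hM hγ hβ0.1 (hrun.mem_feasible hβ0 t).1
    (pow_nonneg hω1 t) (by positivity) (Real.sqrt_nonneg _) (rate_nonneg _ _ _)
    (le_trans (by positivity) (threshold t le_rfl)) (by rwa [mul_assoc A K])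

end Run

section Blocks

variable {p D : ℕ} (blk : Fin p → Fin D)

/-- The vector `u` with all coordinates outside block `d` set to zero. -/
def mask (d : Fin D) (u : Fin p → ℝ) : Fin p → ℝ := fun i => if blk i = d then u i else 0

theorem dotProduct_blockDiag_mulVec (H : Matrix (Fin p) (Fin p) ℝ) (u v : Fin p → ℝ) :
    u ⬝ᵥ blockDiag blk H *ᵥ v = ∑ d, mask blk d u ⬝ᵥ H *ᵥ mask blk d v := by
  have entrywise (i j : Fin p) : (if blk i = blk j then H i j else 0)
      = ∑ d, if blk i = d then if blk j = d then H i j else 0 else 0 := by simp [eq_comm]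
  simp only [dotProduct, mulVec, blockDiag, mask, of_apply, entrywise, Finset.mul_sum,
    Finset.sum_mul]
  rw [Finset.sum_comm_cycle]
  refine Finset.sum_congr rfl fun d _ => Finset.sum_congr rfl fun i _ => Finset.sum_congr rfl
    fun j _ => ?_
  split_ifs <;> simp

theorem sum_dotProduct_mask (u : Fin p → ℝ) :
    ∑ d, mask blk d u ⬝ᵥ mask blk d u = u ⬝ᵥ u := by
  simp only [dotProduct, mask]
  rw [Finset.sum_comm]
  exact Finset.sum_congr rfl fun i _ => by simp [← ite_and]

theorem sum_ite_block (d : Fin D) (f : Fin p → ℝ) :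
    ∑ i, (if blk i = d then f i else 0) = ∑ i : {i // blk i = d}, f i := by
  rw [← Finset.sum_filter]
  exact Finset.sum_subtype _ (by simp) f

theorem mask_dotProduct_mulVec_mask (H : Matrix (Fin p) (Fin p) ℝ) (d : Fin D) (u : Fin p → ℝ) :
    mask blk d u ⬝ᵥ H *ᵥ mask blk d u
      = (fun i : {i // blk i = d} => u i) ⬝ᵥ block blk H d *ᵥ fun i => u i := by
  simp only [dotProduct, mulVec, block, submatrix_apply, mask, ite_mul, zero_mul, mul_ite,
    mul_zero, sum_ite_block blk d]

theorem mask_dotProduct_mask (d : Fin D) (u : Fin p → ℝ) :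
    mask blk d u ⬝ᵥ mask blk d u
      = (fun i : {i // blk i = d} => u i) ⬝ᵥ fun i : {i // blk i = d} => u i := by
  simp only [dotProduct, mask, ite_mul, zero_mul, mul_ite, mul_zero, ← ite_and, and_self, 
    sum_ite_block blk d]

end Blocks

section Spectrum

open scoped MatrixOrder

theorem quad_bounds_of_spectrum_subset {ι : Type*} [Fintype ι] [DecidableEq ι] {A : Matrix ι ι ℝ}
    (hA : A.IsHermitian) {a b : ℝ} (h : spectrum ℝ A ⊆ Set.Icc a b) (v : ι → ℝ) :
    a * (v ⬝ᵥ v) ≤ v ⬝ᵥ A *ᵥ v ∧ v ⬝ᵥ A *ᵥ v ≤ b * (v ⬝ᵥ v) := by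
  have lower : algebraMap ℝ (Matrix ι ι ℝ) a ≤ A :=
    (algebraMap_le_iff_le_spectrum hA).2 fun x hx => (h hx).1
  have upper : A ≤ algebraMap ℝ (Matrix ι ι ℝ) b :=
    (le_algebraMap_iff_spectrum_le hA).2 fun x hx => (h hx).2
  have quad_lower := quad_nonneg (Matrix.le_iff.1 lower) v
  have quad_upper := quad_nonneg (Matrix.le_iff.1 upper) v
  simp only [Algebra.algebraMap_eq_smul_one, sub_mulVec, smul_mulVec, one_mulVec, dotProduct_sub,
    dotProduct_smul, smul_eq_mul, sub_nonneg] at quad_lower quad_upper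
  exact ⟨quad_lower, quad_upper⟩

end Spectrum

section BlockDiag

variable {p D : ℕ} (blk : Fin p → Fin D) {S : Matrix (Fin p) (Fin p) ℝ}

theorem blockDiag_isHermitian (hS : S.IsHermitian) : (blockDiag blk S).IsHermitian := by
  ext i j
  simp [blockDiag, ← hS.apply i j, eq_comm (a := blk i)]

theorem quad_blockDiag_bounds (hS : S.IsHermitian) {a b : ℝ}
    (h : ∀ d, spectrum ℝ (block blk S d) ⊆ Set.Icc a b) (u : Fin p → ℝ) :
    a * (u ⬝ᵥ u) ≤ u ⬝ᵥ blockDiag blk S *ᵥ u ∧ u ⬝ᵥ blockDiag blk S *ᵥ u ≤ b * (u ⬝ᵥ u) := by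
  have block_bounds (d : Fin D) :
      a * (mask blk d u ⬝ᵥ mask blk d u) ≤ mask blk d u ⬝ᵥ S *ᵥ mask blk d u ∧
      mask blk d u ⬝ᵥ S *ᵥ mask blk d u ≤ b * (mask blk d u ⬝ᵥ mask blk d u) := by
    rw [mask_dotProduct_mulVec_mask, mask_dotProduct_mask]
    exact quad_bounds_of_spectrum_subset (hS.submatrix _) (h d) _
  rw [dotProduct_blockDiag_mulVec, ← sum_dotProduct_mask blk u, Finset.mul_sum, Finset.mul_sum]
  exact ⟨Finset.sum_le_sum fun d _ => (block_bounds d).1,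
    Finset.sum_le_sum fun d _ => (block_bounds d).2⟩

theorem posDef_of_mul_dotProduct_self_le {A : Matrix (Fin p) (Fin p) ℝ} (hA : A.IsHermitian)
    {a : ℝ} (ha : 0 < a) (h : ∀ u, a * (u ⬝ᵥ u) ≤ u ⬝ᵥ A *ᵥ u) : A.PosDef :=
  .of_dotProduct_mulVec_pos hA fun u hu =>
    (mul_pos ha (by simpa using dotProduct_star_self_pos_iff.2 hu)).trans_le (by simpa using h u)

theorem one_le_of_quad_le_mul_quad_blockDiag (hL : (blockDiag blk S).PosDef) {ρ : ℝ}
    (h : ∀ u, u ⬝ᵥ S *ᵥ u ≤ ρ * (u ⬝ᵥ blockDiag blk S *ᵥ u)) (i : Fin p) : 1 ≤ ρ := by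
  have diag_eq : blockDiag blk S i i = S i i := by simp [blockDiag]
  have diag_pos : 0 < S i i := diag_eq ▸ hL.diag_pos
  have := h (Pi.single i 1)
  simp only [mulVec_single_one, single_one_dotProduct, col_apply, diag_eq] at this
  exact (le_mul_iff_one_le_left diag_pos).1 this

end BlockDiag

section Population

variable {p : ℕ} {S Lam : Matrix (Fin p) (Fin p) ℝ} {ξ : ℕ → Fin p → ℝ}

theorem isUnitVec_inv_l2norm_smul {w : Fin p → ℝ} (hw : w ≠ 0) :
    IsUnitVec ((l2norm w)⁻¹ • w) := by
  have norm_ne : l2norm w ≠ 0 := l2norm_eq_zero.not.2 hw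
  rw [IsUnitVec, smul_dotProduct, dotProduct_smul, ← l2norm_sq, smul_eq_mul, smul_eq_mul]
  field_simp

theorem rayleigh_smul {c : ℝ} (hc : c ≠ 0) (w : Fin p → ℝ) :
    rayleigh S Lam (c • w) = rayleigh S Lam w := by
  simp only [rayleigh, mulVec_smul, dotProduct_smul, smul_dotProduct, smul_eq_mul]
  rw [mul_div_mul_left _ _ hc, mul_div_mul_left _ _ hc]

theorem rayleigh_nonneg (hS : S.PosSemidef) (hLam : Lam.PosSemidef) (w : Fin p → ℝ) :
    0 ≤ rayleigh S Lam w :=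
  div_nonneg (quad_nonneg hS w) (quad_nonneg hLam w)

theorem IsMCCADirections.quad_le (hξ : IsMCCADirections S Lam ξ) (hLam : Lam.PosDef) {j : ℕ}
    (hj : j ∈ Finset.Icc 1 p) {w : Fin p → ℝ}
    (hw : ∀ j' ∈ Finset.Ico 1 j, w ⬝ᵥ Lam *ᵥ ξ j' = 0) :
    w ⬝ᵥ S *ᵥ w ≤ rayleigh S Lam (ξ j) * (w ⬝ᵥ Lam *ᵥ w) := by
  obtain rfl | hw0 := eq_or_ne w 0
  · simp
  · have quad_pos : 0 < w ⬝ᵥ Lam *ᵥ w := by simpa using hLam.dotProduct_mulVec_pos hw0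
    have le_max : rayleigh S Lam ((l2norm w)⁻¹ • w) ≤ rayleigh S Lam (ξ j) :=
      (hξ j hj).2 ⟨isUnitVec_inv_l2norm_smul hw0, fun j' hj' => by
        rw [smul_dotProduct, hw j' hj', smul_zero]⟩
    rwa [rayleigh_smul (inv_ne_zero (l2norm_eq_zero.not.2 hw0)), rayleigh,
      div_le_iff₀ quad_pos] at le_max

theorem excessMatrix_isHermitian (hS : S.IsHermitian) (hLam : Lam.IsHermitian) (ρ : ℝ) :
    (excessMatrix ρ S Lam).IsHermitian :=
  hLam.sub (hS.smul (IsSelfAdjoint.all _))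

theorem excessMatrix_posSemidef (hS : S.IsHermitian) (hLam : Lam.IsHermitian) {ρ : ℝ} (hρ : 0 < ρ)
    (h : ∀ u, u ⬝ᵥ S *ᵥ u ≤ ρ * (u ⬝ᵥ Lam *ᵥ u)) : (excessMatrix ρ S Lam).PosSemidef := by
  refine .of_dotProduct_mulVec_nonneg (excessMatrix_isHermitian hS hLam ρ) fun u => ?_
  rw [star_trivial, ← excess, excess_eq, sub_nonneg, inv_mul_le_iff₀ hρ]
  exact h u

theorem excess_rayleigh_self {v : Fin p → ℝ} (hv : rayleigh S Lam v ≠ 0) :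
    excess (rayleigh S Lam v) S Lam v = 0 := by
  rw [rayleigh, div_ne_zero_iff] at hv
  rw [excess_eq, rayleigh, inv_div, div_mul_cancel₀ _ hv.1, sub_self]

theorem one_sub_sq_le_dotProduct_self_sub {u v : Fin p → ℝ} (hu : IsUnitVec u) (hv : IsUnitVec v)
    (a : ℝ) : 1 - (u ⬝ᵥ v) ^ 2 ≤ (u - a • v) ⬝ᵥ (u - a • v) := by
  unfold IsUnitVec at hu hv
  simp only [sub_dotProduct, dotProduct_sub, smul_dotProduct, dotProduct_smul, smul_eq_mul, hu,
    hv, dotProduct_comm v u]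
  nlinarith [sq_nonneg (a - u ⬝ᵥ v)]

theorem gap_le_excess {M γ ρ : ℝ} (hM : 0 < M) (hγ : 0 < γ) (hρ : 0 < ρ) (hS : S.IsHermitian)
    (hLam : Lam.PosDef) (hlower : ∀ u, u ⬝ᵥ u ≤ M * (u ⬝ᵥ Lam *ᵥ u)) {v : Fin p → ℝ}
    (hv : IsUnitVec v) (hker : excessMatrix ρ S Lam *ᵥ v = 0)
    (horth : ∀ w, w ⬝ᵥ Lam *ᵥ v = 0 → w ⬝ᵥ S *ᵥ w ≤ (1 - γ) * ρ * (w ⬝ᵥ Lam *ᵥ w))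
    {u : Fin p → ℝ} (hu : IsUnitVec u) :
    γ * (1 - (u ⬝ᵥ v) ^ 2) ≤ M * excess ρ S Lam u := by
  have quad_ne : v ⬝ᵥ Lam *ᵥ v ≠ 0 := fun h0 => by
    have := hlower v
    rw [hv, h0] at this
    linarith
  obtain ⟨a, ha⟩ : ∃ a, (u - a • v) ⬝ᵥ Lam *ᵥ v = 0 :=
    ⟨(u ⬝ᵥ Lam *ᵥ v) / (v ⬝ᵥ Lam *ᵥ v), by
      rw [sub_dotProduct, smul_dotProduct, smul_eq_mul, div_mul_cancel₀ _ quad_ne, sub_self]⟩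
  have excess_sub : excess ρ S Lam (u - a • v) = excess ρ S Lam u := by
    rw [excess, quad_sub (excessMatrix_isHermitian hS hLam.isHermitian ρ), mulVec_smul, hker]
    simp [excess]
  have excess_ge : γ * ((u - a • v) ⬝ᵥ Lam *ᵥ (u - a • v)) ≤ excess ρ S Lam (u - a • v) := by
    have := horth _ ha
    rw [mul_comm _ ρ, mul_assoc, ← inv_mul_le_iff₀ hρ] at this
    rw [excess_eq]
    linarith
  calc γ * (1 - (u ⬝ᵥ v) ^ 2) ≤ γ * ((u - a • v) ⬝ᵥ (u - a • v)) := by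
        gcongr
        exact one_sub_sq_le_dotProduct_self_sub hu hv a
    _ ≤ γ * (M * ((u - a • v) ⬝ᵥ Lam *ᵥ (u - a • v))) := by gcongr; exact hlower _
    _ = M * (γ * ((u - a • v) ⬝ᵥ Lam *ᵥ (u - a • v))) := mul_left_comm ..
    _ ≤ M * excess ρ S Lam u := by gcongr; exact excess_sub ▸ excess_ge

theorem IsMCCADirections.isLeadingPair {M γ : ℝ} (hξ : IsMCCADirections S Lam ξ) (hp : 2 ≤ p)
    (hM : 0 < M) (hγ : 0 < γ) (hS : S.PosSemidef) (hLam : Lam.PosDef)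
    (hlower : ∀ u, u ⬝ᵥ u ≤ M * (u ⬝ᵥ Lam *ᵥ u)) (hupper : ∀ u, u ⬝ᵥ Lam *ᵥ u ≤ M * (u ⬝ᵥ u))
    (hρ : 0 < rayleigh S Lam (ξ 1))
    (hgap : γ * rayleigh S Lam (ξ 1) ≤ rayleigh S Lam (ξ 1) - rayleigh S Lam (ξ 2)) :
    IsLeadingPair M γ (rayleigh S Lam (ξ 1)) S Lam (ξ 1) := by
  have one_mem : 1 ∈ Finset.Icc 1 p := Finset.mem_Icc.2 ⟨le_rfl, by lia⟩
  have two_mem : 2 ∈ Finset.Icc 1 p := Finset.mem_Icc.2 ⟨one_le_two, hp⟩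
  have unit : IsUnitVec (ξ 1) := (hξ 1 one_mem).1.1
  have excess_psd := excessMatrix_posSemidef hS.isHermitian hLam.isHermitian hρ fun u =>
    hξ.quad_le hLam one_mem (by simp)
  have kernel := mulVec_eq_zero_of_quad_eq_zero excess_psd (excess_rayleigh_self hρ.ne')
  have quad_le_of_orthogonal (w : Fin p → ℝ) (hw : w ⬝ᵥ Lam *ᵥ ξ 1 = 0) :
      w ⬝ᵥ S *ᵥ w ≤ (1 - γ) * rayleigh S Lam (ξ 1) * (w ⬝ᵥ Lam *ᵥ w) := by
    refine (hξ.quad_le hLam two_mem (by simpa using hw)).trans ?_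
    have := quad_nonneg hLam.posSemidef w
    gcongr
    linarith
  have gap_le_one : γ ≤ 1 := by
    have := rayleigh_nonneg hS hLam.posSemidef (ξ 2)
    exact (mul_le_iff_le_one_left hρ).1 (by linarith)
  exact ⟨hρ, gap_le_one, unit, hS, hlower, hupper, excess_psd, kernel, fun u hu =>
    gap_le_excess hM hγ hρ hS.isHermitian hLam hlower unit kernel quad_le_of_orthogonal hu⟩

theorem IsMCCADirections.isLeadingPair_blockDiag {D : ℕ} {blk : Fin p → Fin D} {M γ : ℝ}
    (hξ : IsMCCADirections S (blockDiag blk S) ξ) (hp : 2 ≤ p) (hM : 0 < M) (hγ : 0 < γ)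
    (hS : S.PosSemidef) (hspec : ∀ d, spectrum ℝ (block blk S d) ⊆ Set.Icc (1 / M) M)
    (hgap : γ * rayleigh S (blockDiag blk S) (ξ 1)
      ≤ rayleigh S (blockDiag blk S) (ξ 1) - rayleigh S (blockDiag blk S) (ξ 2)) :
    IsLeadingPair M γ (rayleigh S (blockDiag blk S) (ξ 1)) S (blockDiag blk S) (ξ 1) := by
  have bounds := quad_blockDiag_bounds blk hS.isHermitian hspec
  have hLam : (blockDiag blk S).PosDef := posDef_of_mul_dotProduct_self_le
    (blockDiag_isHermitian blk hS.isHermitian) (one_div_pos.2 hM) fun u => (bounds u).1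
  have one_le := one_le_of_quad_le_mul_quad_blockDiag blk hLam (fun u =>
    hξ.quad_le hLam (Finset.mem_Icc.2 ⟨le_rfl, by lia⟩) (by simp)) (⟨0, by lia⟩ : Fin p)
  refine hξ.isLeadingPair hp hM hγ hS hLam (fun u => ?_) (fun u => (bounds u).2) (by linarith) hgap
  rw [← inv_mul_le_iff₀ hM, ← one_div]
  exact (bounds u).1

end Population

section IntegerNet

variable {ι : Type*} [Fintype ι]

theorem exists_intUnit_abs_sub {x : ℤ} (hx : x ≠ 0) : ∃ e : ℤˣ, |x - e| = |x| - 1 := by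
  rcases lt_or_gt_of_ne hx with neg | pos
  · exact ⟨-1, by rw [abs_of_neg neg, abs_of_nonpos] <;> push_cast <;> lia⟩
  · exact ⟨1, by rw [abs_of_pos pos, abs_of_nonneg] <;> push_cast <;> lia⟩

theorem sum_abs_sub_single [DecidableEq ι] (k : ι → ℤ) (i : ι) (e : ℤ) :
    ∑ j, |(k - Pi.single i e : ι → ℤ) j| = ∑ j, |k j| - |k i| + |k i - e| := by
  rw [← Finset.add_sum_erase _ _ (Finset.mem_univ i), ← Finset.add_sum_erase _ _
    (Finset.mem_univ i), Finset.sum_congr rfl fun j hj => by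
      rw [Pi.sub_apply, Pi.single_eq_of_ne (Finset.ne_of_mem_erase hj), sub_zero]]
  simp
  ring

variable (ι) in
theorem exists_finset_forall_sum_abs_le (m : ℕ) : ∃ N : Finset (ι → ℤ),
    N.card ≤ (2 * Fintype.card ι + 1) ^ m ∧ ∀ k : ι → ℤ, ∑ i, |k i| ≤ m → k ∈ N := by
  classical
  induction m with
  | zero =>
    refine ⟨{0}, by simp, fun k hk => ?_⟩
    have := (Finset.sum_eq_zero_iff_of_nonneg fun i _ => abs_nonneg (k i)).1
      (le_antisymm (by simpa using hk) (Finset.sum_nonneg fun i _ => abs_nonneg _))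
    simpa [funext_iff] using this
  | succ m ih =>
    obtain ⟨N, card_le, mem_of_sum_le⟩ := ih
    let shift (k : ι → ℤ) (x : Option (ι × ℤˣ)) : ι → ℤ := k + x.elim 0 fun y => Pi.single y.1 y.2
    refine ⟨Finset.image₂ shift N Finset.univ, ?_, fun k hk => Finset.mem_image₂.2 ?_⟩
    · calc (Finset.image₂ shift N Finset.univ).card
          ≤ N.card * (Finset.univ : Finset (Option (ι × ℤˣ))).card := Finset.card_image₂_le ..
        _ ≤ (2 * Fintype.card ι + 1) ^ m * (2 * Fintype.card ι + 1) := by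
          gcongr
          simp [mul_comm]
        _ = (2 * Fintype.card ι + 1) ^ (m + 1) := (pow_succ ..).symm
    · obtain rfl | hk0 := eq_or_ne k 0
      · exact ⟨0, mem_of_sum_le 0 (by simp), none, Finset.mem_univ _, by simp [shift]⟩
      · obtain ⟨i, hi⟩ := Function.ne_iff.1 hk0
        obtain ⟨e, he⟩ := exists_intUnit_abs_sub hi
        refine ⟨k - Pi.single i (e : ℤ), mem_of_sum_le _ ?_, some (i, e), Finset.mem_univ _,
          by simp [shift]⟩
        rw [sum_abs_sub_single, he]
        push_cast at hk
        linarith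

end IntegerNet

section Rounding

variable {p : ℕ}

theorem exists_int_abs_sub_le_min (x : ℝ) : ∃ k : ℤ, |(k : ℝ)| ≤ |x| ∧ |x - k| ≤ min 1 |x| := by
  have floor_nonneg : (0 : ℝ) ≤ ⌊|x|⌋ := by exact_mod_cast Int.floor_nonneg.2 (abs_nonneg x)
  have floor_le := Int.floor_le |x|
  have lt_floor := Int.lt_floor_add_one |x|
  have trunc_abs : |(|x| - ⌊|x|⌋)| ≤ min 1 |x| := by
    rw [abs_of_nonneg (by linarith)]
    exact le_min (by linarith) (by linarith)
  rcases abs_choice x with h | h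
  · exact ⟨⌊|x|⌋, by rwa [abs_of_nonneg floor_nonneg], by rwa [h] at trunc_abs ⊢⟩
  · refine ⟨-⌊|x|⌋, by rwa [Int.cast_neg, abs_neg, abs_of_nonneg floor_nonneg], ?_⟩
    rwa [Int.cast_neg, ← abs_neg, neg_sub', neg_neg, ← h]

theorem exists_finset_card_eq_forall_le {ι α : Type*} [Fintype ι] [LinearOrder α] {s : ℕ}
    (hs : s ≤ Fintype.card ι) (f : ι → α) :
    ∃ A : Finset ι, A.card = s ∧ ∀ i ∈ A, ∀ j ∉ A, f j ≤ f i := by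
  classical
  induction s with
  | zero => exact ⟨∅, by simp⟩
  | succ s ih =>
    obtain ⟨A, hA, top⟩ := ih (by lia)
    have compl_nonempty : Aᶜ.Nonempty := by
      rw [← Finset.card_pos, Finset.card_compl]
      lia
    obtain ⟨i, hi, hmax⟩ := Finset.exists_max_image Aᶜ f compl_nonempty
    rw [Finset.mem_compl] at hi
    refine ⟨insert i A, by rw [Finset.card_insert_of_notMem hi, hA], fun i' hi' j hj => ?_⟩
    rw [Finset.mem_insert, not_or] at hj
    obtain rfl | hi' := Finset.mem_insert.1 hi'
    · exact hmax j (Finset.mem_compl.2 hj.2)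
    · exact top i' hi' j hj.2

theorem exists_finset_sum_mul_le_sum {ι : Type*} [Fintype ι] {s : ℕ} {f : ι → ℝ}
    (hf : ∀ i, 0 ≤ f i) : ∃ A : Finset ι, A.card ≤ s ∧ ∀ r : ι → ℝ,
      (∀ i, 0 ≤ r i) → (∀ i, r i ≤ 1) → ∑ i, r i ≤ s → ∑ i, r i * f i ≤ ∑ i ∈ A, f i := by
  classical
  obtain hc | hc := le_or_gt (Fintype.card ι) s
  · exact ⟨Finset.univ, hc, fun r _ h1 _ => Finset.sum_le_sum fun i _ =>
      mul_le_of_le_one_left (hf i) (h1 i)⟩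
  obtain ⟨A, hA, top⟩ := exists_finset_card_eq_forall_le hc.le f
  obtain ⟨c, hc0, hcA, hcA'⟩ : ∃ c, 0 ≤ c ∧ (∀ i ∈ A, c ≤ f i) ∧ ∀ j ∉ A, f j ≤ c := by
    obtain ⟨j, hj, hmax⟩ := Finset.exists_max_image Aᶜ f (by
      rw [← Finset.card_pos, Finset.card_compl]
      lia)
    exact ⟨f j, hf j, fun i hi => top i hi j (Finset.mem_compl.1 hj),
      fun i hi => hmax i (Finset.mem_compl.2 hi)⟩
  refine ⟨A, hA.le, fun r h0 h1 hsum => ?_⟩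
  have pointwise (i : ι) : r i * f i ≤ (if i ∈ A then f i else 0)
      + c * (r i - if i ∈ A then 1 else 0) := by
    split_ifs with hi
    · nlinarith [h1 i, hcA i hi]
    · nlinarith [h0 i, hcA' i hi]
  calc ∑ i, r i * f i
      ≤ ∑ i, ((if i ∈ A then f i else 0) + c * (r i - if i ∈ A then 1 else 0)) :=
        Finset.sum_le_sum fun i _ => pointwise i
    _ = ∑ i ∈ A, f i + c * (∑ i, r i - s) := by
        rw [Finset.sum_add_distrib, ← Finset.mul_sum, Finset.sum_sub_distrib]
        simp [hA]
    _ ≤ ∑ i ∈ A, f i := by nlinarith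

theorem exists_int_forall_dotProduct_le (s : ℕ) (w : Fin p → ℝ) :
    ∃ k : Fin p → ℤ, k ⬝ᵥ k ≤ s ∧ ∀ r : Fin p → ℝ, (∀ i, |r i| ≤ 1) → l1norm r ≤ s →
      w ⬝ᵥ r ≤ w ⬝ᵥ (Int.cast ∘ k) := by
  obtain ⟨A, hA, dominates⟩ := exists_finset_sum_mul_le_sum (s := s) fun i => abs_nonneg (w i)
  refine ⟨fun i => if i ∈ A then SignType.sign (w i) else 0, ?_, fun r hr hsum => ?_⟩
  · have sign_mul_self_le : ∀ e : SignType, (e : ℤ) * e ≤ 1 := by decide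
    calc _ ≤ ∑ i, if i ∈ A then (1 : ℤ) else 0 := Finset.sum_le_sum fun i _ => by
          by_cases hi : i ∈ A <;> simp [hi, sign_mul_self_le]
      _ ≤ s := by simpa using hA
  · calc w ⬝ᵥ r ≤ ∑ i, |r i| * |w i| := Finset.sum_le_sum fun i _ => by
          rw [← abs_mul, mul_comm]
          exact le_abs_self _
      _ ≤ ∑ i ∈ A, |w i| := dominates _ (fun i => abs_nonneg _) hr hsum
      _ = w ⬝ᵥ (Int.cast ∘ fun i => if i ∈ A then (SignType.sign (w i) : ℤ) else 0) := by
          simp [dotProduct, Function.comp_apply, apply_ite]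

theorem l2norm_le_mixedNorm (s : ℕ) (u : Fin p → ℝ) : l2norm u ≤ mixedNorm s u :=
  le_add_of_nonneg_right (div_nonneg (l1norm_nonneg u) (Real.sqrt_nonneg _))

theorem l1norm_le_mixedNorm {s : ℕ} (hs : 0 < s) (u : Fin p → ℝ) :
    l1norm u ≤ mixedNorm s u * √(s : ℝ) := by
  rw [← div_le_iff₀ (by positivity), mixedNorm]
  exact le_add_of_nonneg_left (l2norm_nonneg u)

theorem exists_int_rounding {s : ℕ} (hs : 0 < s) {u : Fin p → ℝ} (hu : mixedNorm s u ≤ 1)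
    (w : Fin p → ℝ) : ∃ k₁ k₂ : Fin p → ℤ, k₁ ⬝ᵥ k₁ ≤ s ∧ k₂ ⬝ᵥ k₂ ≤ s ∧
      √(s : ℝ) * (w ⬝ᵥ u) ≤ w ⬝ᵥ (Int.cast ∘ k₁) + w ⬝ᵥ (Int.cast ∘ k₂) := by
  have sqrt_sq : √(s : ℝ) ^ 2 = s := Real.sq_sqrt (Nat.cast_nonneg _)
  choose k abs_k abs_sub using fun i => exists_int_abs_sub_le_min (√(s : ℝ) * u i)
  obtain ⟨k₂, hk₂, remainder_le⟩ := exists_int_forall_dotProduct_le s w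
  refine ⟨k, k₂, ?_, hk₂, ?_⟩
  · have : ∑ i, (k i : ℝ) * k i ≤ s := by
      calc ∑ i, (k i : ℝ) * k i ≤ ∑ i, (√(s : ℝ) * u i) * (√(s : ℝ) * u i) :=
            Finset.sum_le_sum fun i _ => abs_le_iff_mul_self_le.1 (abs_k i)
        _ = (√(s : ℝ) * l2norm u) ^ 2 := by
            rw [mul_pow, l2norm_sq, dotProduct, Finset.mul_sum]
            exact Finset.sum_congr rfl fun i _ => by ring
        _ ≤ (√(s : ℝ) * 1) ^ 2 := by
            have := l2norm_nonneg u
            gcongr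
            exact (l2norm_le_mixedNorm s u).trans hu
        _ = s := by rw [mul_one, sqrt_sq]
    exact_mod_cast this
  · have l1norm_remainder : l1norm (√(s : ℝ) • u - Int.cast ∘ k) ≤ s := by
      calc l1norm (√(s : ℝ) • u - Int.cast ∘ k) ≤ l1norm (√(s : ℝ) • u) :=
            Finset.sum_le_sum fun i _ => (le_min_iff.1 (abs_sub i)).2
        _ = √(s : ℝ) * l1norm u := by rw [l1norm_smul, abs_of_nonneg (Real.sqrt_nonneg _)]
        _ ≤ √(s : ℝ) * (1 * √(s : ℝ)) := by
            gcongr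
            exact (l1norm_le_mixedNorm hs u).trans (by gcongr)
        _ = s := by rw [one_mul, ← sq, sqrt_sq]
    have := remainder_le (√(s : ℝ) • u - Int.cast ∘ k) (fun i => (le_min_iff.1 (abs_sub i)).1)
      l1norm_remainder
    rw [dotProduct_sub, dotProduct_smul, smul_eq_mul] at this
    linarith

end Rounding

section MixedBound

variable {p s : ℕ} {E : Matrix (Fin p) (Fin p) ℝ} {ε : ℝ}

theorem hasMixedBound_of_unit_ball
    (h : ∀ u v, mixedNorm s u ≤ 1 → mixedNorm s v ≤ 1 → u ⬝ᵥ E *ᵥ v ≤ ε) :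
    HasMixedBound s E ε := by
  have mixedNorm_pos {u : Fin p → ℝ} (hu : u ≠ 0) : 0 < mixedNorm s u :=
    ((l2norm_nonneg u).lt_of_ne' (l2norm_eq_zero.not.2 hu)).trans_le (l2norm_le_mixedNorm s u)
  have normalized {u : Fin p → ℝ} (hu : u ≠ 0) : mixedNorm s ((mixedNorm s u)⁻¹ • u) ≤ 1 := by
    rw [mixedNorm_smul, abs_of_pos (inv_pos.2 (mixedNorm_pos hu)),
      inv_mul_cancel₀ (mixedNorm_pos hu).ne']
  have upper (u v : Fin p → ℝ) : u ⬝ᵥ E *ᵥ v ≤ ε * mixedNorm s u * mixedNorm s v := by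
    obtain rfl | hu := eq_or_ne u 0
    · simp [mixedNorm, l2norm, l1norm]
    obtain rfl | hv := eq_or_ne v 0
    · simp [mixedNorm, l2norm, l1norm]
    have := h _ _ (normalized hu) (normalized hv)
    rwa [mulVec_smul, dotProduct_smul, smul_dotProduct, smul_eq_mul, smul_eq_mul,
      inv_mul_le_iff₀' (mixedNorm_pos hv), inv_mul_le_iff₀' (mixedNorm_pos hu),
      mul_right_comm] at this
  refine fun u v => abs_le'.2 ⟨upper u v, ?_⟩
  simpa [mixedNorm_neg] using upper (-u) v

theorem dotProduct_mulVec_intCast_le (hE : E.IsHermitian)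
    (h : ∀ k : Fin p → ℤ, k ⬝ᵥ k ≤ (4 * s : ℕ) →
      |(Int.cast ∘ k) ⬝ᵥ E *ᵥ (Int.cast ∘ k)| ≤ s * ε) {k l : Fin p → ℤ} (hk : k ⬝ᵥ k ≤ s)
    (hl : l ⬝ᵥ l ≤ s) : (Int.cast ∘ k) ⬝ᵥ E *ᵥ (Int.cast ∘ l) ≤ s * ε / 2 := by
  have parallelogram : (k + l) ⬝ᵥ (k + l) + (k - l) ⬝ᵥ (k - l) = 2 * (k ⬝ᵥ k) + 2 * (l ⬝ᵥ l) := by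
    simp only [add_dotProduct, dotProduct_add, sub_dotProduct, dotProduct_sub]
    ring
  have nonneg (k : Fin p → ℤ) : 0 ≤ k ⬝ᵥ k := Finset.sum_nonneg fun i _ => mul_self_nonneg _
  have add_le := h (k + l) (by push_cast; linarith [nonneg (k - l)])
  have sub_le := h (k - l) (by push_cast; linarith [nonneg (k + l)])
  have cast_add : (Int.cast ∘ (k + l) : Fin p → ℝ) = Int.cast ∘ k + Int.cast ∘ l := by
    ext i; simp
  have cast_sub : (Int.cast ∘ (k - l) : Fin p → ℝ) = Int.cast ∘ k - Int.cast ∘ l := by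
    ext i; simp
  rw [cast_add, quad_add hE] at add_le
  rw [cast_sub, quad_sub hE] at sub_le
  linarith [(abs_le.1 add_le).2, (abs_le.1 sub_le).1]

theorem hasMixedBound_of_forall_int (hs : 0 < s) (hE : E.IsHermitian)
    (h : ∀ k : Fin p → ℤ, k ⬝ᵥ k ≤ (4 * s : ℕ) →
      |(Int.cast ∘ k) ⬝ᵥ E *ᵥ (Int.cast ∘ k)| ≤ s * ε) : HasMixedBound s E (2 * ε) := by
  have comm := dotProduct_mulVec_comm_of_isHermitian hE
  have le_of_int {v : Fin p → ℝ} (hv : mixedNorm s v ≤ 1) {k : Fin p → ℤ} (hk : k ⬝ᵥ k ≤ s) :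
      √(s : ℝ) * (v ⬝ᵥ E *ᵥ (Int.cast ∘ k)) ≤ s * ε := by
    obtain ⟨l₁, l₂, hl₁, hl₂, rounding⟩ := exists_int_rounding hs hv (E *ᵥ (Int.cast ∘ k))
    simp only [dotProduct_comm (E *ᵥ _)] at rounding
    linarith [dotProduct_mulVec_intCast_le hE h hl₁ hk, dotProduct_mulVec_intCast_le hE h hl₂ hk]
  refine hasMixedBound_of_unit_ball fun u v hu hv => ?_
  obtain ⟨k₁, k₂, hk₁, hk₂, rounding⟩ := exists_int_rounding hs hu (E *ᵥ v)
  simp only [dotProduct_comm (E *ᵥ _), comm _ v] at rounding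
  have : √(s : ℝ) * (√(s : ℝ) * (v ⬝ᵥ E *ᵥ u)) ≤ s * (2 * ε) := by
    have := mul_le_mul_of_nonneg_left rounding (Real.sqrt_nonneg s)
    linarith [le_of_int hv hk₁, le_of_int hv hk₂]
  rw [← mul_assoc, Real.mul_self_sqrt (Nat.cast_nonneg _)] at this
  rw [comm]
  exact le_of_mul_le_mul_left this (by positivity)

end MixedBound

section Subexponential

variable {Ω ι : Type*} [MeasurableSpace Ω] {P : Measure Ω} {W : Ω → ℝ} {v b : ℝ}

/-- Sub-exponential random variables, with variance proxy `v` and scale `b`: the moment generating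
function is at most that of a centred Gaussian of variance `v` on the interval `|l| ≤ 1 / b`. -/
structure IsSubexponential (W : Ω → ℝ) (v b : ℝ) (P : Measure Ω) : Prop where
  aemeasurable : AEMeasurable W P
  integrable_exp_mul : ∀ l, |l| * b ≤ 1 → Integrable (fun ω => Real.exp (l * W ω)) P
  mgf_le : ∀ l, |l| * b ≤ 1 → mgf W P l ≤ Real.exp (v * l ^ 2 / 2)

namespace IsSubexponential

theorem congr {W' : Ω → ℝ} (h : IsSubexponential W v b P) (hW : W =ᵐ[P] W') :
    IsSubexponential W' v b P where
  aemeasurable := h.aemeasurable.congr hW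
  integrable_exp_mul l hl := (h.integrable_exp_mul l hl).congr <| by
    filter_upwards [hW] with ω hω
    rw [hω]
  mgf_le l hl := mgf_congr hW ▸ h.mgf_le l hl

theorem mono {v' b' : ℝ} (h : IsSubexponential W v b P) (hv : v ≤ v') (hb : b ≤ b') :
    IsSubexponential W v' b' P where
  aemeasurable := h.aemeasurable
  integrable_exp_mul l hl :=
    h.integrable_exp_mul l ((mul_le_mul_of_nonneg_left hb (abs_nonneg l)).trans hl)
  mgf_le l hl := (h.mgf_le l ((mul_le_mul_of_nonneg_left hb (abs_nonneg l)).trans hl)).trans <| by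
    gcongr

theorem const_mul (h : IsSubexponential W v b P) (c : ℝ) :
    IsSubexponential (fun ω => c * W ω) (v * c ^ 2) (b * |c|) P where
  aemeasurable := h.aemeasurable.const_mul c
  integrable_exp_mul l hl := by
    simp only [← mul_assoc]
    exact h.integrable_exp_mul (l * c) (by rw [abs_mul]; linarith)
  mgf_le l hl := by
    rw [mgf_const_mul]
    refine (h.mgf_le (c * l) (by rw [abs_mul]; linarith)).trans_eq ?_
    ring_nf

theorem neg (h : IsSubexponential W v b P) : IsSubexponential (fun ω => -W ω) v b P := by
  simpa using h.const_mul (-1)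

theorem comp_hasLaw {Ω' : Type*} [MeasurableSpace Ω'] {P' : Measure Ω'} {Y : Ω' → Ω}
    (h : IsSubexponential W v b P) (hY : HasLaw Y P P') :
    IsSubexponential (fun ω => W (Y ω)) v b P' := by
  obtain rfl := hY.map_eq
  exact {
    aemeasurable := h.aemeasurable.comp_aemeasurable hY.aemeasurable
    integrable_exp_mul := fun l hl =>
      (h.integrable_exp_mul l hl).comp_aemeasurable hY.aemeasurable
    mgf_le := fun l hl =>
      (mgf_map hY.aemeasurable (h.integrable_exp_mul l hl).aestronglyMeasurable).ge.trans
        (h.mgf_le l hl) }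

end IsSubexponential

theorem exp_mul_sum_le {t : Finset ι} {a : ι → ℝ} (ha : ∀ i ∈ t, 0 < a i) (ht : t.Nonempty)
    (l : ℝ) (x : ι → ℝ) :
    Real.exp (l * ∑ i ∈ t, x i)
      ≤ ∑ i ∈ t, a i / (∑ j ∈ t, a j) * Real.exp (l * (∑ j ∈ t, a j) / a i * x i) := by
  have sum_pos : 0 < ∑ j ∈ t, a j := Finset.sum_pos ha ht
  have jensen := convexOn_exp.map_sum_le (t := t) (w := fun i => a i / ∑ j ∈ t, a j)
    (p := fun i => l * (∑ j ∈ t, a j) / a i * x i) (fun i hi => (div_pos (ha i hi) sum_pos).le)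
    (by rw [← Finset.sum_div, div_self sum_pos.ne']) fun _ _ => Set.mem_univ _
  refine le_of_eq_of_le (congrArg Real.exp ?_) jensen
  rw [Finset.mul_sum]
  refine Finset.sum_congr rfl fun i hi => ?_
  have := (ha i hi).ne'
  rw [smul_eq_mul]
  field_simp

/-- By Jensen's inequality the moment generating function of the sum is at most a convex combination
of those of the terms, however dependent these are. -/
theorem IsSubexponential.sum [IsProbabilityMeasure P] {t : Finset ι} {W : ι → Ω → ℝ} {a : ι → ℝ}
    (ha : ∀ i ∈ t, 0 < a i) (h : ∀ i ∈ t, IsSubexponential (W i) (v * a i ^ 2) (b * a i) P) :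
    IsSubexponential (fun ω => ∑ i ∈ t, W i ω) (v * (∑ i ∈ t, a i) ^ 2) (b * ∑ i ∈ t, a i) P := by
  obtain rfl | ht := t.eq_empty_or_nonempty
  · exact ⟨by simp, by simp, by simp [mgf]⟩
  have sum_pos : 0 < ∑ j ∈ t, a j := Finset.sum_pos ha ht
  set q := ∑ j ∈ t, a j
  have aemeasurable : AEMeasurable (fun ω => ∑ i ∈ t, W i ω) P :=
    Finset.aemeasurable_fun_sum t fun i hi => (h i hi).aemeasurable
  have scaled {l : ℝ} (hl : |l| * (b * q) ≤ 1) {i : ι} (hi : i ∈ t) :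
      |l * q / a i| * (b * a i) ≤ 1 := by
    have := ha i hi
    rw [abs_div, abs_mul, abs_of_pos sum_pos, abs_of_pos this]
    refine le_of_eq_of_le ?_ hl
    field_simp
  have term_integrable {l : ℝ} (hl : |l| * (b * q) ≤ 1) (i : ι) (hi : i ∈ t) :
      Integrable (fun ω => a i / q * Real.exp (l * q / a i * W i ω)) P :=
    ((h i hi).integrable_exp_mul _ (scaled hl hi)).const_mul _
  have integrable {l : ℝ} (hl : |l| * (b * q) ≤ 1) :
      Integrable (fun ω => Real.exp (l * ∑ i ∈ t, W i ω)) P := by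
    refine (integrable_finsetSum t (term_integrable hl)).mono'
      (aemeasurable.const_mul l).exp.aestronglyMeasurable <| ae_of_all _ fun ω => ?_
    rw [Real.norm_of_nonneg (Real.exp_nonneg _)]
    exact exp_mul_sum_le ha ht l _
  refine ⟨aemeasurable, fun l hl => integrable hl, fun l hl => ?_⟩
  calc mgf (fun ω => ∑ i ∈ t, W i ω) P l
      ≤ ∫ ω, ∑ i ∈ t, a i / q * Real.exp (l * q / a i * W i ω) ∂P :=
        integral_mono (integrable hl) (integrable_finsetSum t (term_integrable hl))
          fun ω => exp_mul_sum_le ha ht l _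
    _ = ∑ i ∈ t, a i / q * mgf (W i) P (l * q / a i) := by
        rw [integral_finsetSum t (term_integrable hl)]
        simp only [integral_const_mul, mgf]
    _ ≤ ∑ i ∈ t, a i / q * Real.exp (v * q ^ 2 * l ^ 2 / 2) := by
        refine Finset.sum_le_sum fun i hi => ?_
        have := ha i hi
        refine mul_le_mul_of_nonneg_left ?_ (by positivity)
        refine ((h i hi).mgf_le _ (scaled hl hi)).trans_eq (congrArg Real.exp ?_)
        field_simp
    _ = Real.exp (v * q ^ 2 * l ^ 2 / 2) := by
        rw [← Finset.sum_mul, ← Finset.sum_div, div_self sum_pos.ne', one_mul]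

theorem IsSubexponential.sum_of_iIndepFun [Fintype ι] {W : ι → Ω → ℝ} (hind : iIndepFun W P)
    (h : ∀ i, IsSubexponential (W i) v b P) :
    IsSubexponential (fun ω => ∑ i, W i ω) (Fintype.card ι * v) b P := by
  have := hind.isProbabilityMeasure
  have mgf_sum (l : ℝ) : mgf (fun ω => ∑ i, W i ω) P l = ∏ i, mgf (W i) P l := by
    rw [← hind.mgf_sum₀ (fun i => (h i).aemeasurable), Finset.sum_fn]
  refine ⟨Finset.aemeasurable_fun_sum _ fun i _ => (h i).aemeasurable, fun l hl => ?_,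
    fun l hl => ?_⟩
  · rw [← mgf_pos_iff, mgf_sum]
    exact Finset.prod_pos fun i _ => mgf_pos ((h i).integrable_exp_mul l hl)
  · rw [mgf_sum]
    refine (Finset.prod_le_prod (fun i _ => mgf_nonneg) fun i _ => (h i).mgf_le l hl).trans_eq ?_
    rw [Finset.prod_const, Finset.card_univ, ← Real.exp_nat_mul]
    ring_nf

theorem IsSubexponential.measureReal_ge_le [IsFiniteMeasure P] (h : IsSubexponential W v b P)
    (hv : 0 < v) {x : ℝ} (hx : 0 ≤ x) (hxv : x * b ≤ v) :
    P.real {ω | x ≤ W ω} ≤ Real.exp (-(x ^ 2 / (2 * v))) := by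
  have in_range : |x / v| * b ≤ 1 := by
    rwa [abs_of_nonneg (by positivity), div_mul_eq_mul_div, div_le_one hv]
  calc P.real {ω | x ≤ W ω} ≤ Real.exp (-(x / v) * x) * mgf W P (x / v) :=
        measure_ge_le_exp_mul_mgf x (by positivity) (h.integrable_exp_mul _ in_range)
    _ ≤ Real.exp (-(x / v) * x) * Real.exp (v * (x / v) ^ 2 / 2) := by
        gcongr
        exact h.mgf_le _ in_range
    _ = Real.exp (-(x ^ 2 / (2 * v))) := by
        rw [← Real.exp_add]
        congr 1
        field_simp
        ring

theorem IsSubexponential.measure_abs_ge_le [IsFiniteMeasure P] (h : IsSubexponential W v b P)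
    (hv : 0 < v) {x : ℝ} (hx : 0 ≤ x) (hxv : x * b ≤ v) :
    P {ω | x ≤ |W ω|} ≤ ENNReal.ofReal (2 * Real.exp (-(x ^ 2 / (2 * v)))) := by
  rw [← ofReal_measureReal]
  refine ENNReal.ofReal_le_ofReal ?_
  have union : {ω | x ≤ |W ω|} = {ω | x ≤ W ω} ∪ {ω | x ≤ -W ω} :=
    Set.ext fun ω => le_abs (α := ℝ)
  rw [union, two_mul]
  exact (measureReal_union_le _ _).trans
    (add_le_add (h.measureReal_ge_le hv hx hxv) (h.neg.measureReal_ge_le hv hx hxv))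

end Subexponential

section ChiSquare

theorem exp_neg_sub_two_mul_sq_le {y : ℝ} (hy : |y| ≤ 1 / 2) :
    Real.exp (-y - 2 * y ^ 2) ≤ 1 - y := by
  obtain ⟨-, hy'⟩ := abs_le.1 hy
  have log_bound := Real.abs_log_sub_add_sum_range_le (x := y) (by linarith) 1
  simp only [Finset.sum_range_one, zero_add, pow_one, Nat.cast_zero, div_one, one_add_one_eq_two,
    sq_abs] at log_bound
  have : y ^ 2 / (1 - |y|) ≤ 2 * y ^ 2 := by
    rw [div_le_iff₀ (by linarith)]
    nlinarith [sq_nonneg y]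
  rw [← Real.le_log_iff_exp_le (by linarith)]
  linarith [(abs_le.1 log_bound).1]

theorem gaussianPDFReal_mul_exp_mul_sq (l z : ℝ) :
    gaussianPDFReal 0 1 z * Real.exp (l * z ^ 2)
      = (√(2 * Real.pi))⁻¹ * Real.exp (-(1 / 2 - l) * z ^ 2) := by
  simp only [gaussianPDFReal, NNReal.coe_one, mul_one, sub_zero]
  rw [mul_assoc, ← Real.exp_add]
  ring_nf

variable {l : ℝ}

theorem integrable_exp_mul_sq_gaussianReal (hl : l < 1 / 2) :
    Integrable (fun z => Real.exp (l * z ^ 2)) (gaussianReal 0 1) := by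
  rw [gaussianReal_of_var_ne_zero 0 one_ne_zero, integrable_withDensity_iff_integrable_smul'
    (measurable_gaussianPDF 0 1) (ae_of_all _ fun _ => gaussianPDF_lt_top)]
  simp only [toReal_gaussianPDF, smul_eq_mul, gaussianPDFReal_mul_exp_mul_sq]
  exact (integrable_exp_neg_mul_sq (by linarith)).const_mul _

theorem integral_exp_mul_sq_gaussianReal (hl : l < 1 / 2) :
    ∫ z, Real.exp (l * z ^ 2) ∂(gaussianReal 0 1) = (√(1 - 2 * l))⁻¹ := by
  have : 1 / 2 - l ≠ 0 := by linarith
  have : 1 - 2 * l ≠ 0 := by linarith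
  rw [integral_gaussianReal_eq_integral_smul one_ne_zero]
  simp only [smul_eq_mul, gaussianPDFReal_mul_exp_mul_sq]
  rw [integral_const_mul, integral_gaussian, ← Real.sqrt_inv, ← Real.sqrt_mul (by positivity),
    ← Real.sqrt_inv]
  congr 1
  field_simp

theorem isSubexponential_sq_sub_one :
    IsSubexponential (fun z => z ^ 2 - 1) 8 4 (gaussianReal 0 1) := by
  have exp_eq (l z : ℝ) : Real.exp (l * (z ^ 2 - 1)) = Real.exp (-l) * Real.exp (l * z ^ 2) := by
    rw [← Real.exp_add]
    ring_nf
  refine ⟨by fun_prop, fun l hl => ?_, fun l hl => ?_⟩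
  · simp only [exp_eq]
    exact (integrable_exp_mul_sq_gaussianReal (by linarith [le_abs_self l])).const_mul _
  have : l ≤ 1 / 4 := by linarith [le_abs_self l]
  have sqrt_bound : Real.exp (-l - 4 * l ^ 2) ≤ √(1 - 2 * l) := by
    refine Real.le_sqrt_of_sq_le ?_
    rw [← Real.exp_nat_mul]
    refine le_of_eq_of_le (congrArg Real.exp ?_)
      (exp_neg_sub_two_mul_sq_le (y := 2 * l) (by rw [abs_mul, abs_two]; linarith))
    push_cast
    ring
  simp only [mgf, exp_eq, integral_const_mul]
  rw [integral_exp_mul_sq_gaussianReal (by linarith), ← div_eq_mul_inv,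
    div_le_iff₀ (Real.sqrt_pos.2 (by linarith))]
  calc Real.exp (-l) = Real.exp (8 * l ^ 2 / 2) * Real.exp (-l - 4 * l ^ 2) := by
        rw [← Real.exp_add]
        ring_nf
    _ ≤ Real.exp (8 * l ^ 2 / 2) * √(1 - 2 * l) := by gcongr

variable {Ω ι : Type*} [MeasurableSpace Ω] {P : Measure Ω}

theorem isSubexponential_sq_sub_of_hasLaw {Y : Ω → ℝ} {a : ℝ≥0} (ha : a ≠ 0)
    (hY : HasLaw Y (gaussianReal 0 a) P) :
    IsSubexponential (fun ω => Y ω ^ 2 - a) (8 * a ^ 2) (4 * a) P := by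
  have : (0 : ℝ) < a := by positivity
  have standardized : HasLaw (fun ω => Y ω / √(a : ℝ)) (gaussianReal 0 1) P := by
    refine HasLaw.fun_comp (Y := fun y => y / √(a : ℝ)) ⟨by fun_prop, ?_⟩ hY
    rw [gaussianReal_map_div_const, zero_div]
    congr 1
    ext
    simp [Real.sq_sqrt, ha]
  have scaled := (isSubexponential_sq_sub_one.comp_hasLaw standardized).const_mul a
  rw [abs_of_pos this] at scaled
  simpa only [div_pow, Real.sq_sqrt this.le, mul_sub, mul_div_cancel₀ _ this.ne', mul_one]
    using scaled

theorem isSubexponential_sum_sq_sub [IsProbabilityMeasure P] [Fintype ι] {Y : ι → Ω → ℝ}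
    {a : ι → ℝ≥0} (hY : ∀ i, HasLaw (Y i) (gaussianReal 0 (a i)) P) :
    IsSubexponential (fun ω => ∑ i, (Y i ω ^ 2 - a i)) (8 * (∑ i, (a i : ℝ)) ^ 2)
      (4 * ∑ i, (a i : ℝ)) P := by
  classical
  have degenerate : ∀ᵐ ω ∂P, ∀ i, a i = 0 → Y i ω = 0 := by
    refine ae_all_iff.2 fun i => ?_
    obtain hi | hi := eq_or_ne (a i) 0
    · have law := hY i
      rw [hi, gaussianReal_zero_var] at law
      filter_upwards [law.ae_eq_of_dirac] with ω hω _ using hω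
    · exact ae_of_all _ fun ω h => absurd h hi
  have nondegenerate := IsSubexponential.sum (t := {i | a i ≠ 0}) (a := fun i => (a i : ℝ))
    (fun i hi => by simpa [pos_iff_ne_zero] using hi)
    fun i hi => isSubexponential_sq_sub_of_hasLaw (Finset.mem_filter.1 hi).2 (hY i)
  rw [Finset.sum_filter_of_ne fun i _ hi => by simpa using hi] at nondegenerate
  refine nondegenerate.congr ?_
  filter_upwards [degenerate] with ω hω
  refine Finset.sum_filter_of_ne fun i _ hi h_zero => hi ?_
  simp [h_zero, hω i h_zero]

end ChiSquare

section EmpiricalCovariance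

variable {Ω : Type*} [MeasurableSpace Ω] {P : Measure Ω} {n p D s : ℕ}
  {S : Matrix (Fin p) (Fin p) ℝ}

theorem hasLaw_dotProduct (hS : S.PosSemidef) {x : Ω → Fin p → ℝ}
    (hx : HasLaw (fun ω => WithLp.toLp 2 (x ω)) (multivariateGaussian 0 S) P) (w : Fin p → ℝ) :
    HasLaw (fun ω => x ω ⬝ᵥ w) (gaussianReal 0 (w ⬝ᵥ S *ᵥ w).toNNReal) P := by
  have law_inner : HasLaw (innerSL ℝ (WithLp.toLp 2 w)) (gaussianReal 0 (w ⬝ᵥ S *ᵥ w).toNNReal)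
      (multivariateGaussian 0 S) := by
    refine ⟨by fun_prop, ?_⟩
    rw [IsGaussian.map_eq_gaussianReal]
    congr 1
    · rw [ContinuousLinearMap.integral_comp_id_comm IsGaussian.integrable_id]
      simp
    · have variance := covarianceBilin_multivariateGaussian (μ := 0) hS (WithLp.toLp 2 w)
        (WithLp.toLp 2 w)
      rw [covarianceBilin_self IsGaussian.memLp_two_id] at variance
      exact congrArg Real.toNNReal variance
  refine (law_inner.comp hx).congr (ae_of_all _ fun ω => ?_)
  simp [EuclideanSpace.inner_toLp_toLp]

theorem dotProduct_empCov_mulVec (X : Matrix (Fin n) (Fin p) ℝ) (w : Fin p → ℝ) :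
    w ⬝ᵥ empCov X *ᵥ w = (n : ℝ)⁻¹ * ∑ k, (X k ⬝ᵥ w) ^ 2 := by
  rw [empCov, smul_mulVec, dotProduct_smul, smul_eq_mul, ← mulVec_mulVec, dotProduct_mulVec,
    vecMul_transpose]
  congr 1
  exact Finset.sum_congr rfl fun k _ => (pow_two _).symm

theorem sum_sum_sq_dotProduct_mask_sub (hn : 0 < n) (blk : Fin p → Fin D)
    (X : Matrix (Fin n) (Fin p) ℝ) (H : Matrix (Fin p) (Fin p) ℝ) (u : Fin p → ℝ) :
    ∑ k, (∑ d, (X k ⬝ᵥ mask blk d u) ^ 2 - u ⬝ᵥ H *ᵥ u)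
      = n * (u ⬝ᵥ (blockDiag blk (empCov X) - H) *ᵥ u) := by
  have : (n : ℝ) ≠ 0 := by positivity
  rw [sub_mulVec, dotProduct_sub, dotProduct_blockDiag_mulVec, Finset.sum_sub_distrib,
    Finset.sum_comm]
  simp only [dotProduct_empCov_mulVec, Finset.sum_const, Finset.card_univ, Fintype.card_fin,
    nsmul_eq_mul, ← Finset.mul_sum]
  field_simp

theorem empCov_isHermitian (X : Matrix (Fin n) (Fin p) ℝ) : (empCov X).IsHermitian := by
  rw [IsHermitian, conjTranspose_eq_transpose_of_trivial, empCov, transpose_smul, transpose_mul,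
    transpose_transpose]

theorem isSubexponential_sum_sq_dotProduct_mask [IsProbabilityMeasure P] (blk : Fin p → Fin D)
    (hS : S.PosSemidef) {x : Ω → Fin p → ℝ}
    (hx : HasLaw (fun ω => WithLp.toLp 2 (x ω)) (multivariateGaussian 0 S) P) (u : Fin p → ℝ) :
    IsSubexponential (fun ω => ∑ d, (x ω ⬝ᵥ mask blk d u) ^ 2 - u ⬝ᵥ blockDiag blk S *ᵥ u)
      (8 * (u ⬝ᵥ blockDiag blk S *ᵥ u) ^ 2) (4 * (u ⬝ᵥ blockDiag blk S *ᵥ u)) P := by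
  have variance_sum : ∑ d, ((mask blk d u ⬝ᵥ S *ᵥ mask blk d u).toNNReal : ℝ)
      = u ⬝ᵥ blockDiag blk S *ᵥ u := by
    rw [dotProduct_blockDiag_mulVec]
    exact Finset.sum_congr rfl fun d _ => Real.coe_toNNReal _ (quad_nonneg hS _)
  have chi_square := isSubexponential_sum_sq_sub fun d => hasLaw_dotProduct hS hx (mask blk d u)
  simpa only [Finset.sum_sub_distrib, variance_sum] using chi_square

theorem isSubexponential_quad_empCov_sub [IsProbabilityMeasure P] (hn : 0 < n)
    (blk : Fin p → Fin D) (hS : S.PosSemidef) {X : Ω → Matrix (Fin n) (Fin p) ℝ}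
    (hX : IsGaussianSample P S X) (u : Fin p → ℝ) :
    IsSubexponential (fun ω => n * (u ⬝ᵥ (blockDiag blk (empCov (X ω)) - blockDiag blk S) *ᵥ u))
      (n * (8 * (u ⬝ᵥ blockDiag blk S *ᵥ u) ^ 2)) (4 * (u ⬝ᵥ blockDiag blk S *ᵥ u)) P := by
  have indep : iIndepFun (fun k ω => ∑ d, (X ω k ⬝ᵥ mask blk d u) ^ 2
      - u ⬝ᵥ blockDiag blk S *ᵥ u) P :=
    hX.indep.comp (fun _ x => ∑ d, (x ⬝ᵥ mask blk d u) ^ 2 - u ⬝ᵥ blockDiag blk S *ᵥ u)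
      fun _ => by simp only [dotProduct]; fun_prop
  have rows := IsSubexponential.sum_of_iIndepFun indep fun k =>
    isSubexponential_sum_sq_dotProduct_mask blk hS (hX.law k) u
  rw [Fintype.card_fin] at rows
  exact rows.congr <| ae_of_all _ fun ω => sum_sum_sq_dotProduct_mask_sub hn blk _ _ u

theorem measure_abs_quad_empCov_sub_ge_le [IsProbabilityMeasure P] (hn : 0 < n)
    (blk : Fin p → Fin D) (hS : S.PosSemidef) {X : Ω → Matrix (Fin n) (Fin p) ℝ}
    (hX : IsGaussianSample P S X) {A τ : ℝ} (hA : 0 < A) (hτ : 0 ≤ τ) (hτ' : τ ≤ 2)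
    {u : Fin p → ℝ} (hu : u ⬝ᵥ blockDiag blk S *ᵥ u ≤ A) :
    P {ω | A * τ ≤ |u ⬝ᵥ (blockDiag blk (empCov (X ω)) - blockDiag blk S) *ᵥ u|}
      ≤ ENNReal.ofReal (2 * Real.exp (-(n * τ ^ 2 / 16))) := by
  have quad_nonneg : 0 ≤ u ⬝ᵥ blockDiag blk S *ᵥ u := by
    rw [dotProduct_blockDiag_mulVec]
    exact Finset.sum_nonneg fun d _ => quad_nonneg hS _
  have subexponential : IsSubexponential _ (n * (8 * A ^ 2)) (4 * A) P :=
    (isSubexponential_quad_empCov_sub hn blk hS hX u).mono (by gcongr) (by gcongr)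
  convert subexponential.measure_abs_ge_le (x := n * (A * τ)) (by positivity) (by positivity)
    (by nlinarith [mul_nonneg (mul_nonneg n.cast_nonneg (sq_nonneg A)) (sub_nonneg.2 hτ')]) using 4
  · rw [abs_mul, Nat.abs_cast]
    exact (mul_le_mul_iff_right₀ (by positivity)).symm
  · field_simp
    ring

theorem exists_finset_mem_iff_dotProduct_self_le (hp : 2 ≤ p) (s : ℕ) :
    ∃ N : Finset (Fin p → ℤ), N.card ≤ p ^ (12 * s) ∧ ∀ k, k ∈ N ↔ k ⬝ᵥ k ≤ (4 * s : ℕ) := by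
  obtain ⟨N, hcard, hN⟩ := exists_finset_forall_sum_abs_le (Fin p) (4 * s)
  refine ⟨{k ∈ N | k ⬝ᵥ k ≤ (4 * s : ℕ)}, ?_, fun k => ?_⟩
  · calc _ ≤ N.card := Finset.card_filter_le _ _
      _ ≤ (2 * p + 1) ^ (4 * s) := by simpa using hcard
      _ ≤ (p ^ 3) ^ (4 * s) := Nat.pow_le_pow_left (by nlinarith [Nat.mul_le_mul hp hp]) _
      _ = p ^ (12 * s) := by rw [← pow_mul]; ring_nf
  · refine Finset.mem_filter.trans (and_iff_right_of_imp fun hk => hN k (le_trans ?_ hk))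
    refine Finset.sum_le_sum fun i _ => ?_
    rw [← abs_mul_abs_self]
    exact Int.le_self_sq _ |>.trans_eq (sq _)

theorem measure_not_hasMixedBound_le (hp : 2 ≤ p) (hs : 0 < s)
    {E : Ω → Matrix (Fin p) (Fin p) ℝ} (hE : ∀ ω, (E ω).IsHermitian) {ε : ℝ} {δ : ℝ≥0∞}
    (h : ∀ k : Fin p → ℤ, k ⬝ᵥ k ≤ (4 * s : ℕ) →
      P {ω | s * ε ≤ |(Int.cast ∘ k) ⬝ᵥ E ω *ᵥ (Int.cast ∘ k)|} ≤ δ) :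
    P {ω | ¬ HasMixedBound s (E ω) (2 * ε)} ≤ p ^ (12 * s) * δ := by
  obtain ⟨N, hcard, hN⟩ := exists_finset_mem_iff_dotProduct_self_le hp s
  set bad : (Fin p → ℤ) → Set Ω :=
    fun k => {ω | s * ε ≤ |(Int.cast ∘ k) ⬝ᵥ E ω *ᵥ (Int.cast ∘ k)|}
  have subset_bad : {ω | ¬ HasMixedBound s (E ω) (2 * ε)} ⊆ ⋃ k ∈ N, bad k := by
    refine fun ω hω => by_contra fun good => hω ?_
    refine hasMixedBound_of_forall_int hs (hE ω) fun k hk => le_of_not_ge fun hbad => ?_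
    exact good (Set.mem_biUnion ((hN k).2 hk) hbad)
  calc P {ω | ¬ HasMixedBound s (E ω) (2 * ε)} ≤ P (⋃ k ∈ N, bad k) := measure_mono subset_bad
    _ ≤ ∑ k ∈ N, P (bad k) := measure_biUnion_finset_le _ _
    _ ≤ ∑ _k ∈ N, δ := Finset.sum_le_sum fun k hk => h k ((hN k).1 hk)
    _ = N.card * δ := by rw [Finset.sum_const, nsmul_eq_mul]
    _ ≤ p ^ (12 * s) * δ := by
        gcongr
        exact_mod_cast hcard

theorem natCast_pow_mul_ofReal_exp_le (hp : 0 < p) (hs : 0 < s) :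
    (p : ℝ≥0∞) ^ (12 * s) * ENNReal.ofReal (2 * Real.exp (-(16 * (s * Real.log p))))
      ≤ ENNReal.ofReal (2 / p) := by
  have : (1 : ℝ) ≤ p := by exact_mod_cast hp
  have exp_eq : Real.exp (-(16 * (s * Real.log p))) = ((p : ℝ) ^ (16 * s))⁻¹ := by
    rw [Real.exp_neg, ← Real.exp_log (show (0 : ℝ) < p by positivity), ← Real.exp_nat_mul,
      Real.exp_log (by positivity)]
    push_cast
    ring_nf
  rw [exp_eq, ← ENNReal.ofReal_natCast, ← ENNReal.ofReal_pow (by positivity),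
    ← ENNReal.ofReal_mul (by positivity)]
  refine ENNReal.ofReal_le_ofReal ?_
  calc (p : ℝ) ^ (12 * s) * (2 * ((p : ℝ) ^ (16 * s))⁻¹) = 2 / (p : ℝ) ^ (4 * s) := by
        rw [show 16 * s = 12 * s + 4 * s by ring, pow_add]
        field_simp
    _ ≤ 2 / p := by
        gcongr
        exact le_self_pow₀ this (by positivity)

theorem measure_not_hasMixedBound_empCov_sub_le [IsProbabilityMeasure P] (hn : 0 < n) (hp : 2 ≤ p)
    (hs : 0 < s) (blk : Fin p → Fin D) (hS : S.PosSemidef) {X : Ω → Matrix (Fin n) (Fin p) ℝ}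
    (hX : IsGaussianSample P S X) {A : ℝ} (hA : 0 < A)
    (hSA : ∀ u, u ⬝ᵥ blockDiag blk S *ᵥ u ≤ A * (u ⬝ᵥ u)) (hr : √(rate s p n) ≤ 1 / 8) :
    P {ω | ¬ HasMixedBound s (blockDiag blk (empCov (X ω)) - blockDiag blk S)
        (A * (128 * √(rate s p n)))} ≤ ENNReal.ofReal (2 / p) := by
  have n_mul_sq : n * (16 * √(rate s p n)) ^ 2 / 16 = 16 * (s * Real.log p) := by
    rw [mul_pow, Real.sq_sqrt (rate_nonneg s p n), rate]
    field_simp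
  have hermitian (ω : Ω) : (blockDiag blk (empCov (X ω)) - blockDiag blk S).IsHermitian :=
    (blockDiag_isHermitian blk (empCov_isHermitian _)).sub
      (blockDiag_isHermitian blk hS.isHermitian)
  have pointwise (k : Fin p → ℤ) (hk : k ⬝ᵥ k ≤ (4 * s : ℕ)) :
      P {ω | s * (4 * A * (16 * √(rate s p n)))
          ≤ |(Int.cast ∘ k) ⬝ᵥ (blockDiag blk (empCov (X ω)) - blockDiag blk S) *ᵥ (Int.cast ∘ k)|}
        ≤ ENNReal.ofReal (2 * Real.exp (-(16 * (s * Real.log p)))) := by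
    have self_le : (Int.cast ∘ k : Fin p → ℝ) ⬝ᵥ (Int.cast ∘ k) ≤ 4 * s := by
      simp only [dotProduct, Function.comp_apply] at hk ⊢
      exact_mod_cast hk
    convert measure_abs_quad_empCov_sub_ge_le hn blk hS hX (A := 4 * s * A)
      (τ := 16 * √(rate s p n)) (by positivity) (by positivity) (by linarith)
      ((hSA (Int.cast ∘ k)).trans <| (mul_le_mul_of_nonneg_left self_le hA.le).trans_eq <|
        mul_comm _ _) using 5
    · ring
    · exact n_mul_sq.symm
  rw [show A * (128 * √(rate s p n)) = 2 * (4 * A * (16 * √(rate s p n))) by ring]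
  exact (measure_not_hasMixedBound_le hp hs hermitian pointwise).trans
    (natCast_pow_mul_ofReal_exp_le (by positivity) hs)

theorem blockDiag_const {p : ℕ} (H : Matrix (Fin p) (Fin p) ℝ) :
    blockDiag (fun _ => (0 : Fin 1)) H = H := by
  ext i j
  simp [blockDiag]

theorem IsLeadingPair.measure_not_isPerturbedPair_empCov_le {Ω : Type*} [MeasurableSpace Ω]
    {P : Measure Ω} [IsProbabilityMeasure P] {n p D : ℕ} {M γ ρ : ℝ} {blk : Fin p → Fin D}
    {S : Matrix (Fin p) (Fin p) ℝ} {ξ : Fin p → ℝ}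
    (h : IsLeadingPair M γ ρ S (blockDiag blk S) ξ) (hM : 0 < M) (hn : 0 < n) (hp : 2 ≤ p)
    {X : Ω → Matrix (Fin n) (Fin p) ℝ} (hX : IsGaussianSample P S X)
    (hr : √(rate (l0norm ξ) p n) ≤ 1 / 8) :
    P {ω | ¬ IsPerturbedPair M γ ρ (128 * M * √(rate (l0norm ξ) p n)) S (blockDiag blk S)
        (empCov (X ω)) (blockDiag blk (empCov (X ω))) ξ} ≤ ENNReal.ofReal (4 / p) := by
  have rho_M_pos := mul_pos h.rho_pos hM
  have cov := measure_not_hasMixedBound_empCov_sub_le hn hp h.unit.l0norm_pos (fun _ => (0 : Fin 1))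
    h.cov_posSemidef hX rho_M_pos (fun u => by
      rw [blockDiag_const, mul_assoc]
      exact (h.cov_le u).trans (mul_le_mul_of_nonneg_left (h.diag_upper u) h.rho_pos.le)) hr
  have diag := measure_not_hasMixedBound_empCov_sub_le hn hp h.unit.l0norm_pos blk h.cov_posSemidef
    hX hM h.diag_upper hr
  refine (measure_mono fun ω hω => ?_).trans ((measure_union_le _ _).trans
    ((add_le_add cov diag).trans_eq ?_))
  · refine not_and_or.1 fun ⟨cov_bound, diag_bound⟩ => hω ⟨h, by positivity, ?_, ?_⟩
    · simpa only [blockDiag_const, mul_assoc, mul_left_comm M] using cov_bound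
    · simpa only [mul_assoc, mul_left_comm M] using diag_bound
  · rw [← ENNReal.ofReal_add (by positivity) (by positivity)]
    ring_nf

end EmpiricalCovariance

end MsCCA

open MsCCA Filter Topology in
theorem theorem1_general (M γ c₀ η c₁ c₂ : ℝ) (hM : 0 < M) (hγ : 0 < γ) (hc₀ : 0 < c₀)
    (hc₀' : c₀ < 1) (hη : 0 < η) (hη' : η ≤ 1 / (6 * M)) (hc₁ : 0 < c₁) (hc₂ : 0 < c₂) :
    ∃ ψ₁ > (0 : ℝ), ∃ ψ₂ > (0 : ℝ),
      ∀ (p D s : ℕ → ℕ) (blk : ∀ n, Fin (p n) → Fin (D n))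
        (S Lam : ∀ n, Matrix (Fin (p n)) (Fin (p n)) ℝ) (ξ : ∀ n, ℕ → Fin (p n) → ℝ)
        (ρ : ℕ → ℕ → ℝ) (Linf : ℕ → ℝ) (L B : ℕ → ℕ → ℝ) (ν : ℝ)
        (Ω : ℕ → Type*) [∀ n, MeasurableSpace (Ω n)]
        (P : ∀ n, MeasureTheory.Measure (Ω n)) [∀ n, MeasureTheory.IsProbabilityMeasure (P n)]
        (X : ∀ n, Ω n → Matrix (Fin n) (Fin (p n)) ℝ),
        Tendsto p atTop atTop →
        (∀ n, (S n).PosSemidef) →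
        (∀ n, Lam n = blockDiag (blk n) (S n)) →
        (∀ n d, spectrum ℝ (block (blk n) (S n) d) ⊆ Set.Icc (1 / M) M) →
        (∀ n, IsGaussianSample (P n) (S n) (X n)) →
        (∀ n, IsMCCADirections (S n) (Lam n) (ξ n)) →
        (∀ n j, ρ n j = rayleigh (S n) (Lam n) (ξ n j)) →
        (∀ n, γ * ρ n 1 ≤ ρ n 1 - ρ n 2) →
        (∀ n, s n = l0norm (ξ n 1)) →
        Tendsto (fun n => rate (s n) (p n) n) atTop (𝓝 0) →
        (∀ n, 0 ≤ Linf n ∧ Linf n ≤ (1 + c₁) * √(s n : ℝ)) →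
        (∀ n t, L n t = bound c₁ c₂ η (Linf n) (s n) (p n) n t) →
        ν = (1 - c₀) * γ ^ 2 / M →
        (∀ n t, B n t = L n t - l1norm (ξ n 1)) →
        Tendsto (fun n => P n {ω | ¬ ∀ β : ℕ → Fin (p n) → ℝ,
            IsUnitVec (β 0) → l1norm (β 0) ≤ L n 0 → disc (ξ n 1) (β 0) ≤ ψ₁ →
            IsProximalRun (empCov (X n ω)) (blockDiag (blk n) (empCov (X n ω))) η (L n) β →
            ∀ t : ℕ, (t : ℕ∞) ≤ stopTime c₁ c₂ ν (s n) (p n) n (B n) →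
              disc (ξ n 1) (β t) ≤
                ψ₂ * (disc (ξ n 1) (β 0) * (1 - η * ν) ^ t + rate (s n) (p n) n
                  + √(rate (s n) (p n) n)
                    * (B n t / √(s n : ℝ) + B n t ^ 2 / (s n : ℝ)))})
          atTop (𝓝 0) := by
  obtain ⟨ψ₁, hψ₁, ψ₂, hψ₂, r₁, hr₁, disc_bound⟩ := exists_disc_bound (K := 128 * M) hM hγ hc₀ hc₀'
    rfl hη (by rwa [le_div_iff₀ (by positivity), mul_comm] at hη') hc₁ hc₂ (by positivity)
  refine ⟨ψ₁, hψ₁, ψ₂, hψ₂, ?_⟩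
  intro p D s blk S Lam ξ ρ Linf L B ν Ω _ P _ X hp hS hLam hspec hX hξ hρ hgap hs hrate hLinf hL
    rfl hB
  obtain rfl : Lam = fun n => blockDiag (blk n) (S n) := funext hLam
  obtain rfl : s = fun n => l0norm (ξ n 1) := funext hs
  obtain rfl : ρ = fun n j => rayleigh (S n) (blockDiag (blk n) (S n)) (ξ n j) := funext₂ hρ
  have sqrt_rate_tendsto : Tendsto (fun n => √(rate (l0norm (ξ n 1)) (p n) n)) atTop (𝓝 0) := by
    simpa using hrate.sqrt
  have failure_tendsto : Tendsto (fun n => ENNReal.ofReal (4 / p n)) atTop (𝓝 0) := by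
    simpa using ENNReal.tendsto_ofReal
      ((tendsto_natCast_atTop_atTop.comp hp).const_div_atTop (4 : ℝ))
  refine tendsto_of_tendsto_of_tendsto_of_le_of_le' tendsto_const_nhds failure_tendsto
    (Eventually.of_forall fun _ => zero_le) ?_
  filter_upwards [eventually_gt_atTop 0, hp.eventually_ge_atTop 2,
    sqrt_rate_tendsto.eventually_le_const hr₁,
    sqrt_rate_tendsto.eventually_le_const (by norm_num : (0 : ℝ) < 1 / 8)] with n hn hpn hr hr'
  have leading := (hξ n).isLeadingPair_blockDiag hpn hM hγ (hS n) (hspec n) (hgap n)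
  refine (MeasureTheory.measure_mono fun ω => mt fun perturbed β unit l1_le disc_le run => ?_).trans
    (leading.measure_not_isPerturbedPair_empCov_le hM hn hpn (hX n) hr')
  exact disc_bound perturbed hr (hLinf n).1 (hLinf n).2 (funext (hL n)) (funext (hB n))
    ⟨unit, l1_le⟩ disc_le run

/-- The constants `ψ₁, ψ₂` depend only on `M, γ, c₀, η, c₁, c₂`. The sample size is `n`; all other
objects may vary with `n`. The error bound holds simultaneously for all admissible initial
vectors (which may thus depend on the data) and all runs of the algorithm, outside an event whose
(outer) probability tends to zero. -/
theorem theorem1 (M γ c₀ η c₁ c₂ : ℝ) (hM : 0 < M) (hγ : 0 < γ) (hc₀ : 0 < c₀) (hc₀' : c₀ < 1)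
    (hη : 0 < η) (hη' : η ≤ (1 - c₀) / (2 * M * (M + 3))) (hc₁ : 0 < c₁) (hc₂ : 0 < c₂) :
    ∃ ψ₁ > (0 : ℝ), ∃ ψ₂ > (0 : ℝ),
      ∀ (C : ℝ) (p D s : ℕ → ℕ) (blk : ∀ n, Fin (p n) → Fin (D n))
        (S Lam : ∀ n, Matrix (Fin (p n)) (Fin (p n)) ℝ) (ξ : ∀ n, ℕ → Fin (p n) → ℝ)
        (ρ : ℕ → ℕ → ℝ) (Linf : ℕ → ℝ) (L B : ℕ → ℕ → ℝ) (ν : ℝ)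
        (Ω : ℕ → Type*) [∀ n, MeasurableSpace (Ω n)]
        (P : ∀ n, MeasureTheory.Measure (Ω n)) [∀ n, MeasureTheory.IsProbabilityMeasure (P n)]
        (X : ∀ n, Ω n → Matrix (Fin n) (Fin (p n)) ℝ),
        0 < C →
        (∀ n, 2 ≤ p n) →
        Filter.Tendsto p Filter.atTop Filter.atTop →
        -- covariance, its block-diagonal part, and the data
        (∀ n, (S n).PosSemidef) →
        (∀ n i, S n i i = 1) →
        (∀ n, Lam n = MsCCA.blockDiag (blk n) (S n)) →
        (∀ n d, spectrum ℝ (MsCCA.block (blk n) (S n) d) ⊆ Set.Icc (1 / M) M) →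
        (∀ n, MsCCA.IsGaussianSample (P n) (S n) (X n)) →
        -- population directions, eigen-gap, sparsity
        (∀ n, MsCCA.IsMCCADirections (S n) (Lam n) (ξ n)) →
        (∀ n j, ρ n j = MsCCA.rayleigh (S n) (Lam n) (ξ n j)) →
        (∀ n, 1 + C ≤ ρ n 1) →
        (∀ n, γ * ρ n 1 ≤ ρ n 1 - ρ n 2) →
        (∀ n, s n = MsCCA.l0norm (ξ n 1)) →
        Filter.Tendsto (fun n => MsCCA.rate (s n) (p n) n) Filter.atTop (nhds 0) →
        -- the sequence of bounds
        (∀ n, 1 ≤ Linf n ∧ Linf n ≤ (1 + c₁) * √(s n : ℝ)) →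
        (∀ n t, L n t = MsCCA.bound c₁ c₂ η (Linf n) (s n) (p n) n t) →
        ν = (1 - c₀) * γ ^ 2 / M →
        (∀ n t, B n t = L n t - MsCCA.l1norm (ξ n 1)) →
        Filter.Tendsto (fun n => P n {ω | ¬ ∀ β : ℕ → Fin (p n) → ℝ,
            MsCCA.IsUnitVec (β 0) →
            MsCCA.l1norm (β 0) ≤ L n 0 →
            MsCCA.disc (ξ n 1) (β 0) ≤ ψ₁ →
            MsCCA.IsProximalRun (MsCCA.empCov (X n ω))
              (MsCCA.blockDiag (blk n) (MsCCA.empCov (X n ω))) η (L n) β →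
            ∀ t : ℕ, (t : ℕ∞) ≤ MsCCA.stopTime c₁ c₂ ν (s n) (p n) n (B n) →
              MsCCA.disc (ξ n 1) (β t) ≤
                ψ₂ * (MsCCA.disc (ξ n 1) (β 0) * (1 - η * ν) ^ t + MsCCA.rate (s n) (p n) n
                  + √(MsCCA.rate (s n) (p n) n)
                    * (B n t / √(s n : ℝ) + B n t ^ 2 / (s n : ℝ)))})
          Filter.atTop (nhds 0) := by
  obtain ⟨ψ₁, hψ₁, ψ₂, hψ₂, disc_bound⟩ := theorem1_general M γ c₀ η c₁ c₂ hM hγ hc₀ hc₀' hη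
    (hη'.trans (div_le_div₀ one_pos.le (by linarith) (by positivity) (by nlinarith))) hc₁ hc₂
  exact ⟨ψ₁, hψ₁, ψ₂, hψ₂, fun _ p D s blk S Lam ξ ρ Linf L B ν Ω _ P _ X _ _ hp hS _ hLam hspec hX
    hξ hρ _ hgap hs hrate hLinf => disc_bound p D s blk S Lam ξ ρ Linf L B ν Ω P X hp hS hLam hspec
      hX hξ hρ hgap hs hrate fun n => ⟨zero_le_one.trans (hLinf n).1, (hLinf n).2⟩⟩
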